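/- Let $\mathbb K\in\{\mathbb R,\mathbb C\}$, let $V,H$ be Hilbert spaces over $\mathbb K$ with $V$ continuously and densely embedded in $H$, and let $V'$ be the space of bounded antilinear functionals on $V$. Identify $x\in H$ with the functional $w\mapsto (x\,|\,w)_H$ in $V'$, so that $V\hookrightarrow H\hookrightarrow V'$. Let $\tau>0$ and let $\mathfrak a\colon[0,\tau]\times V\times V\to\mathbb K$ be such that (a) $\mathfrak a(t,\cdot,\cdot)$ is sesquilinear for all $t\in[0,\tau]$; (b) $\mathfrak a(\cdot,v,w)$ is measurable for all $v,w\in V$; (c) there is $M\ge 0$ with $|\mathfrak a(t,v,w)|\le M\|v\|_V\|w\|_V$ for all $t\in[0,\tau]$, $v,w\in V$; (d) there are $\omega\in\mathbb R$, $\alpha>0$ with $\operatorname{Re}\mathfrak a(t,v,v)+\omega\|v\|_H^2\ge\alpha\|v\|_V^2$ for all $t\in[0,\tau]$, $v\in V$. Let $\langle\mathcal A(t)v,w\rangle=\mathfrak a(t,v,w)$ and $\mathrm{MR}(V,V')=H^1(0,\tau;V')\cap L^2(0,\tau;V)$; for $u\in \mathrm{MR}(V,V')$ the values $u(0),u(\tau)\in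 H$ are those of the representative of $u$ in $C([0,\tau];H)$. For $f\in L^2(0,\tau;V')$, the equation $\dot u+\mathcal A(\cdot)u=f$ means that for every $w\in V$ one has $\langle\dot u(t),w\rangle+\mathfrak a(t,u(t),w)=\langle f(t),w\rangle$ for almost every $t\in(0,\tau)$ (if $V$ is separable, this says that $\dot u(t)+\mathcal A(t)u(t)=f(t)$ in $V'$ for almost every $t$). For every $x\in H$ there is a unique $v\in\mathrm{MR}(V,V')$ with $\dot v+\mathcal A(\cdot)v=0$ and $v(0)=x$, and $T(\tau)x:=v(\tau)$ defines a linear operator $T(\tau)\colon H\to H$. Let $\Phi\colon H\to H$ be linear. Then the following are equivalent: (i) for every $f\in L^2(0,\tau;V')$ there is a unique $u\in\mathrm{MR}(V,V')$ with $\dot u+\mathcal A(\cdot)u=f$ and $u(0)=\Phi u(\tau)$; (ii) $I-\Phi T(\tau)\colon H\to H$ is bijective. -/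

import Mathlib

open MeasureTheory Set
open scoped ContDiff

noncomputable section

namespace LionsProblem

/-- The antidual `V'` of `V`: bounded antilinear functionals on `V`
(for `𝕜 = ℝ` this is the usual dual space). -/
abbrev AntiDual (𝕜 V : Type*) [RCLike 𝕜] [NormedAddCommGroup V] [InnerProductSpace 𝕜 V] :=
  V →L⋆[𝕜] 𝕜

/-- Lebesgue measure on the interval `(0, τ)`. -/
abbrev vol (τ : ℝ) : Measure ℝ := volume.restrict (Ioo 0 τ)

/-- The space `L²(0, τ; X)`. -/
abbrev L2 (τ : ℝ) (X : Type*) [NormedAddCommGroup X] := Lp X 2 (vol τ)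

section

variable {𝕜 V H : Type*} [RCLike 𝕜]
  [NormedAddCommGroup V] [InnerProductSpace 𝕜 V]
  [NormedAddCommGroup H] [InnerProductSpace 𝕜 H]

/-- The Gelfand triple embedding `H → V'`, where `V` is embedded in `H` by `ι`:
`x : H` is identified with the antilinear functional `w ↦ (x | w)_H`. -/
def toAntiDual (ι : V →L[𝕜] H) (x : H) : AntiDual 𝕜 V := (innerSLFlip 𝕜 x).comp ι

/-- Mathlib's inner product is linear in its second argument. -/
theorem toAntiDual_apply (ι : V →L[𝕜] H) (x : H) (w : V) :
    toAntiDual ι x w = inner 𝕜 (ι w) x := rfl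

/-- `a(t, ·, ·)`, `t ∈ [0, τ]`, is a non-autonomous form on `V` (linear in the first and antilinear
in the second argument): measurable in time, uniformly bounded, and quasi-coercive with respect
to `H`. Values of `a` at times outside `[0, τ]` play no role. -/
structure IsQuasiCoerciveForm (ι : V →L[𝕜] H) (τ : ℝ)
    (a : ℝ → V →ₗ[𝕜] V →ₗ⋆[𝕜] 𝕜) : Prop where
  measurable : ∀ v w : V, AEMeasurable (fun t => a t v w) (volume.restrict (Icc 0 τ))
  bounded : ∃ M : ℝ, 0 ≤ M ∧ ∀ t ∈ Icc 0 τ, ∀ v w : V, ‖a t v w‖ ≤ M * ‖v‖ * ‖w‖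
  quasiCoercive : ∃ ω₀ α : ℝ, 0 < α ∧ ∀ t ∈ Icc 0 τ, ∀ v : V,
    α * ‖v‖ ^ 2 ≤ RCLike.re (a t v v) + ω₀ * ‖ι v‖ ^ 2

/-- `g ∈ L²(0, τ; V')` is the weak derivative of `u ∈ L²(0, τ; V)`, where `V ⊆ H ⊆ V'`. -/
def IsWeakDeriv (ι : V →L[𝕜] H) (τ : ℝ) (u : L2 τ V) (g : L2 τ (AntiDual 𝕜 V)) : Prop :=
  ∀ φ : ℝ → ℝ, ContDiff ℝ ∞ φ → HasCompactSupport φ → tsupport φ ⊆ Ioo 0 τ →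
    ∫ t, deriv φ t • toAntiDual ι (ι (u t)) ∂(vol τ) = - ∫ t, φ t • g t ∂(vol τ)

/-- `u ∈ H¹(0, τ; V') ∩ L²(0, τ; V)` and `u' + 𝒜(·) u = f`, where `⟨𝒜(t) v, w⟩ = a(t, v, w)`.
The equation is tested with every `w : V`; if `V` is separable, this is the same as
`u'(t) + 𝒜(t) u(t) = f(t)` in `V'` for almost every `t`
(see `forall_ae_iff_ae_forall`). For non-separable `V` the measurability of the scalar functions
`a(·, v, w)` does not make `𝒜(·) u` strongly measurable, and the tested equation is
the equation in `L²(0, τ; V')`. -/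
def SolvesEquation (ι : V →L[𝕜] H) (τ : ℝ) (a : ℝ → V →ₗ[𝕜] V →ₗ⋆[𝕜] 𝕜)
    (f : L2 τ (AntiDual 𝕜 V)) (u : L2 τ V) : Prop :=
  ∃ g : L2 τ (AntiDual 𝕜 V), IsWeakDeriv ι τ u g ∧
    ∀ w : V, ∀ᵐ t ∂(vol τ), g t w + a t (u t) w = f t w

/-- `c` is the continuous representative of `u` in `C([0, τ]; H)`; `u(0)` and `u(τ)` mean `c 0` and
`c τ`. -/
def IsContRep (ι : V →L[𝕜] H) (τ : ℝ) (u : L2 τ V) (c : ℝ → H) : Prop :=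
  ContinuousOn c (Icc 0 τ) ∧ ∀ᵐ t ∂(vol τ), c t = ι (u t)

/-- `u ∈ H¹(0, τ; V') ∩ L²(0, τ; V)`, `u' + 𝒜(·) u = f` and `u(0) = x`. -/
def SolvesInitial (ι : V →L[𝕜] H) (τ : ℝ) (a : ℝ → V →ₗ[𝕜] V →ₗ⋆[𝕜] 𝕜)
    (f : L2 τ (AntiDual 𝕜 V)) (x : H) (u : L2 τ V) : Prop :=
  SolvesEquation ι τ a f u ∧ ∃ c, IsContRep ι τ u c ∧ c 0 = x

/-- `u ∈ H¹(0, τ; V') ∩ L²(0, τ; V)`, `u' + 𝒜(·) u = f` and `u(0) = Φ u(τ)`. -/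
def SolvesGeneralized (ι : V →L[𝕜] H) (τ : ℝ) (a : ℝ → V →ₗ[𝕜] V →ₗ⋆[𝕜] 𝕜)
    (Φ : H →ₗ[𝕜] H) (f : L2 τ (AntiDual 𝕜 V)) (u : L2 τ V) : Prop :=
  SolvesEquation ι τ a f u ∧ ∃ c, IsContRep ι τ u c ∧ c 0 = Φ (c τ)

/-- The problem with `u(0) = Φ u(τ)` is well-posed: unique solvability for each right-hand side. -/
def WellPosed (ι : V →L[𝕜] H) (τ : ℝ) (a : ℝ → V →ₗ[𝕜] V →ₗ⋆[𝕜] 𝕜) (Φ : H →ₗ[𝕜] H) : Prop :=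
  ∀ f : L2 τ (AntiDual 𝕜 V), ∃! u : L2 τ V, SolvesGeneralized ι τ a Φ f u

/-- `T x = v(τ)`, where `v` is the unique solution of `v' + 𝒜(·) v = 0`, `v(0) = x`. -/
def IsSolutionOperator (ι : V →L[𝕜] H) (τ : ℝ) (a : ℝ → V →ₗ[𝕜] V →ₗ⋆[𝕜] 𝕜)
    (T : H →ₗ[𝕜] H) : Prop :=
  ∀ x : H, (∃! v : L2 τ V, SolvesInitial ι τ a 0 x v) ∧
    ∀ v : L2 τ V, SolvesInitial ι τ a 0 x v → ∃ c, IsContRep ι τ v c ∧ c τ = T x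

/-- In a separable `V` the tested equation is the equation in `V'` for almost every `t`. -/
theorem forall_ae_iff_ae_forall [TopologicalSpace.SeparableSpace V]
    {ι : V →L[𝕜] H} {τ : ℝ} {a : ℝ → V →ₗ[𝕜] V →ₗ⋆[𝕜] 𝕜} (ha : IsQuasiCoerciveForm ι τ a)
    (g f : L2 τ (AntiDual 𝕜 V)) (u : L2 τ V) :
    (∀ w : V, ∀ᵐ t ∂(vol τ), g t w + a t (u t) w = f t w) ↔
      ∀ᵐ t ∂(vol τ), ∀ w : V, g t w + a t (u t) w = f t w := by
  refine ⟨fun h => ?_, fun h w => h.mono fun t ht => ht w⟩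
  obtain ⟨M, -, hM⟩ := ha.bounded
  have h1 : ∀ᵐ t ∂(vol τ), ∀ n, g t (TopologicalSpace.denseSeq V n) +
      a t (u t) (TopologicalSpace.denseSeq V n) = f t (TopologicalSpace.denseSeq V n) :=
    ae_all_iff.2 fun n => h _
  filter_upwards [h1, ae_restrict_mem measurableSet_Ioo] with t ht htm
  have hc : Continuous fun w => a t (u t) w :=
    AddMonoidHomClass.continuous_of_bound (a t (u t)) (M * ‖u t‖)
      fun w => hM t (Ioo_subset_Icc_self htm) _ w
  have := (TopologicalSpace.denseRange_denseSeq V).equalizer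
    ((g t).continuous.add hc) (f t).continuous (funext ht)
  exact fun w => congrFun this w

end

end LionsProblem

end

/-! The theorem reduces to Lions' theorem: the initial value problem is uniquely solvable for every
`f` and every `x`. Every solution of the equation is `w + v`, with `w` the solution for `f` that
starts at `0` and `v` the homogeneous solution that starts at `x`. The condition `u(0) = Φ u(τ)`
then reads `x - Φ T x = Φ w(τ)`, so bijectivity of `I - Φ T` gives well-posedness. Conversely, a
vector in the kernel of `I - Φ T` starts a homogeneous solution of the generalized problem, whence
injectivity. For surjectivity let `v` start at `y` and put `z = (1 - t/τ) v`. Then `z(0) = y`, `z(τ)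
= 0` and `z' + 𝒜z = -v/τ`. If `u` solves the generalized problem with this right-hand side, `u - z`
is a homogeneous solution ending at `u(τ)`, so `T(u(0) - y) = u(τ)` and `(I - Φ T)(y - u(0)) = y`.
This is `wellPosed_iff_bijective`.

Lions' theorem is proved over `ℝ`, by taking real parts, and with `V'` identified with `V` by Riesz;
the embedding `V → V'` becomes `gram ι`, that is `ι† ι`. By du Bois-Reymond a function `u` of the
maximal regularity space satisfies `ι† ι u = C + ∫ p` with `p ∈ L²(0, τ; V)`. Smoothing by
resolvents of `ι† ι` gives the continuous representative in `H` and the energy identity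
(`exists_continuousOn_rep`). Uniqueness follows by Grönwall (`RealSolves.eq_zero`), existence from a
Hahn-Banach representation argument with an exponentially weighted coercivity estimate
(`exists_realSolves`).

No separability of `V` is assumed, so `t ↦ 𝒜(t)u(t)` may fail to be strongly measurable; it is
replaced by the element of `L²(0, τ; V)` that represents the integrated form. -/

noncomputable section

namespace LionsProblem

/-! ### Product rule for vector-valued primitives -/

section Primitives

variable {X Y Z : Type*} [NormedAddCommGroup X] [NormedSpace ℝ X]
  [NormedAddCommGroup Y] [NormedSpace ℝ Y] [NormedAddCommGroup Z] [NormedSpace ℝ Z]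

theorem setIntegral_Ioc_inter_Iio {a b t : ℝ} (ht : t ∈ Ioc a b) (p : ℝ → X) :
    ∫ s in Ioc a b, (Iio t).indicator p s = ∫ s in a..t, p s := by
  rw [integral_indicator measurableSet_Iio, Measure.restrict_restrict measurableSet_Iio,
    intervalIntegral.integral_of_le ht.1.le, integral_Ioc_eq_integral_Ioo]
  congr 2
  ext s
  simp only [mem_inter_iff, mem_Iio, mem_Ioc, mem_Ioo]
  exact ⟨fun h => ⟨h.2.1, h.1⟩, fun h => ⟨h.2, h.1, h.2.le.trans ht.2⟩⟩

theorem setIntegral_Ioc_inter_Iic {a b t : ℝ} (ht : t ∈ Ioc a b) (p : ℝ → X) :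
    ∫ s in Ioc a b, (Iic t).indicator p s = ∫ s in a..t, p s := by
  rw [integral_indicator measurableSet_Iic, Measure.restrict_restrict measurableSet_Iic,
    intervalIntegral.integral_of_le ht.1.le]
  congr 2
  ext s
  simp only [mem_inter_iff, mem_Iic, mem_Ioc]
  exact ⟨fun h => ⟨h.2.1, h.1⟩, fun h => ⟨h.2, h.1, h.2.trans ht.2⟩⟩

/-- The product rule for the primitives vanishing at `a` of two integrable functions. -/
theorem bilin_integral_integral [CompleteSpace X] [CompleteSpace Y] [CompleteSpace Z]
    (L : X →L[ℝ] Y →L[ℝ] Z) {a b : ℝ} (hab : a ≤ b)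
    {p : ℝ → X} {q : ℝ → Y} (hp : IntegrableOn p (Ioc a b)) (hq : IntegrableOn q (Ioc a b)) :
    L (∫ s in a..b, p s) (∫ s in a..b, q s) =
      ∫ t in a..b, (L (p t) (∫ s in a..t, q s) + L (∫ s in a..t, p s) (q t)) := by
  set μ := volume.restrict (Ioc a b)
  have hf : Integrable (fun z : ℝ × ℝ => L (p z.1) (q z.2)) (μ.prod μ) :=
    Integrable.op_fst_snd (op := fun x y => L x y) (by fun_prop)
      ⟨‖L‖, fun x y => L.le_opNorm₂ x y⟩ hp hq
  -- Fubini on the square: the diagonal cuts it into `s < t` and its complement, and each piece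
  -- yields one of the two terms of the product rule.
  have hT : MeasurableSet {z : ℝ × ℝ | z.1 < z.2} := measurableSet_lt measurable_fst measurable_snd
  have e2 : ∀ t ∈ Ioc a b, ∫ s, {z : ℝ × ℝ | z.1 < z.2}.indicator
      (fun z : ℝ × ℝ => L (p z.1) (q z.2)) (s, t) ∂μ = L (∫ s in a..t, p s) (q t) := by
    intro t ht
    have : ∀ s, ({z : ℝ × ℝ | z.1 < z.2}.indicator (fun z : ℝ × ℝ => L (p z.1) (q z.2)) (s, t)) =
        L.flip (q t) ((Iio t).indicator p s) := by
      intro s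
      by_cases h : s < t <;> simp [indicator, h]
    simp only [this]
    rw [ContinuousLinearMap.integral_comp_comm _ (hp.indicator measurableSet_Iio),
      setIntegral_Ioc_inter_Iio ht]
    rfl
  have e3 : ∀ t ∈ Ioc a b, ∫ s, {z : ℝ × ℝ | z.1 < z.2}ᶜ.indicator
      (fun z : ℝ × ℝ => L (p z.1) (q z.2)) (t, s) ∂μ = L (p t) (∫ s in a..t, q s) := by
    intro t ht
    have : ∀ s, ({z : ℝ × ℝ | z.1 < z.2}ᶜ.indicator
        (fun z : ℝ × ℝ => L (p z.1) (q z.2)) (t, s)) = L (p t) ((Iic t).indicator q s) := by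
      intro s
      by_cases h : t < s
      · simp [indicator, h, h.not_ge]
      · simp [indicator, h, not_lt.1 h]
    simp only [this]
    rw [ContinuousLinearMap.integral_comp_comm _ (hq.indicator measurableSet_Iic),
      setIntegral_Ioc_inter_Iic ht]
  have i2 := (hf.indicator hT).integral_prod_right.congr
    ((ae_restrict_mem measurableSet_Ioc).mono e2)
  have i3 := (hf.indicator hT.compl).integral_prod_left.congr
    ((ae_restrict_mem measurableSet_Ioc).mono e3)
  have h1 : ∫ z, L (p z.1) (q z.2) ∂(μ.prod μ) = L (∫ s, p s ∂μ) (∫ s, q s ∂μ) :=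
    integral_prod_bilin L hp hq
  rw [intervalIntegral.integral_of_le hab, intervalIntegral.integral_of_le hab,
    intervalIntegral.integral_of_le hab, integral_add i3 i2, ← h1,
    ← integral_add_compl hT hf, ← integral_indicator hT, ← integral_indicator hT.compl,
    integral_prod_symm _ (hf.indicator hT), integral_prod _ (hf.indicator hT.compl),
    setIntegral_congr_fun measurableSet_Ioc e2, setIntegral_congr_fun measurableSet_Ioc e3,
    add_comm]

theorem continuousOn_primitive_Icc {a b : ℝ} {p : ℝ → X} (hp : IntegrableOn p (Ioc a b)) :
    ContinuousOn (fun t => ∫ s in a..t, p s) (Icc a b) := by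
  have := intervalIntegral.continuousOn_primitive (μ := volume)
    (integrableOn_Icc_iff_integrableOn_Ioc (by simp) |>.2 hp)
  refine this.congr fun t ht => ?_
  exact intervalIntegral.integral_of_le ht.1

theorem integrableOn_bilin_continuousOn (L : X →L[ℝ] Y →L[ℝ] Z) {a b : ℝ}
    {P : ℝ → X} {q : ℝ → Y} (hP : ContinuousOn P (Icc a b)) (hq : IntegrableOn q (Ioc a b)) :
    IntegrableOn (fun t => L (P t) (q t)) (Ioc a b) := by
  obtain ⟨C, hC⟩ := isCompact_Icc.exists_bound_of_continuousOn hP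
  refine Integrable.mono' (hq.norm.const_mul (‖L‖ * C)) ?_ ?_
  · exact L.aestronglyMeasurable_comp₂
      ((hP.mono Ioc_subset_Icc_self).aestronglyMeasurable measurableSet_Ioc) hq.1
  · filter_upwards [ae_restrict_mem measurableSet_Ioc] with t ht
    refine (L.le_opNorm₂ _ _).trans ?_
    gcongr
    exact hC t (Ioc_subset_Icc_self ht)

/-- The product rule for absolutely continuous functions, given as primitives. -/
theorem bilin_primitive_sub [CompleteSpace X] [CompleteSpace Y] [CompleteSpace Z]
    (L : X →L[ℝ] Y →L[ℝ] Z) {a b : ℝ} (hab : a ≤ b)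
    {p : ℝ → X} {q : ℝ → Y} (hp : IntegrableOn p (Ioc a b)) (hq : IntegrableOn q (Ioc a b))
    (x : X) (y : Y) :
    L (x + ∫ s in a..b, p s) (y + ∫ s in a..b, q s) - L x y =
      ∫ t in a..b, (L (p t) (y + ∫ s in a..t, q s) + L (x + ∫ s in a..t, p s) (q t)) := by
  have i1 : IntegrableOn (fun t => L (p t) (∫ s in a..t, q s)) (Ioc a b) :=
    integrableOn_bilin_continuousOn L.flip (continuousOn_primitive_Icc hq) hp
  have i2 : IntegrableOn (fun t => L (∫ s in a..t, p s) (q t)) (Ioc a b) :=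
    integrableOn_bilin_continuousOn L (continuousOn_primitive_Icc hp) hq
  have i3 : IntegrableOn (fun t => L (p t) y) (Ioc a b) := (L.flip y).integrable_comp hp
  have i4 : IntegrableOn (fun t => L x (q t)) (Ioc a b) := (L x).integrable_comp hq
  have e3 : ∫ t in Ioc a b, L (p t) y = L (∫ t in Ioc a b, p t) y :=
    (L.flip y).integral_comp_comm hp
  have e4 : ∫ t in Ioc a b, L x (q t) = L x (∫ t in Ioc a b, q t) := (L x).integral_comp_comm hq
  have key := bilin_integral_integral L hab hp hq
  rw [intervalIntegral.integral_of_le hab, intervalIntegral.integral_of_le hab,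
    intervalIntegral.integral_of_le hab] at key ⊢
  have e : (fun t => L (p t) (y + ∫ s in a..t, q s) + L (x + ∫ s in a..t, p s) (q t)) =
      fun t => (L (p t) y + L x (q t)) +
        (L (p t) (∫ s in a..t, q s) + L (∫ s in a..t, p s) (q t)) := by
    ext t
    simp only [map_add, add_apply]
    abel
  rw [e, integral_add (by exact i3.add i4) (by exact i1.add i2), integral_add i3 i4, e3, e4, ← key]
  simp only [map_add, add_apply]
  abel

end Primitives

/-! ### Test functions and the lemma of du Bois-Reymond -/

section TestFunctions

variable {X : Type*} [NormedAddCommGroup X] [NormedSpace ℝ X] {τ : ℝ}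

theorem integrableOn_Ioc_of_vol {E : Type*} [NormedAddCommGroup E] {p : ℝ → E}
    (hp : Integrable p (vol τ)) :
    IntegrableOn p (Ioc 0 τ) :=
  (integrableOn_Ioc_iff_integrableOn_Ioo (by simp)).2 hp

theorem integral_vol (hτ : 0 < τ) (p : ℝ → X) : ∫ t, p t ∂(vol τ) = ∫ t in 0..τ, p t := by
  rw [intervalIntegral.integral_of_le hτ.le, integral_Ioc_eq_integral_Ioo]

/-- The test functions on `(0, τ)`. -/
structure IsTest (τ : ℝ) (φ : ℝ → ℝ) : Prop where
  contDiff : ContDiff ℝ ∞ φ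
  hasCompactSupport : HasCompactSupport φ
  tsupport_subset : tsupport φ ⊆ Ioo 0 τ

theorem IsTest.apply_eq_zero {φ : ℝ → ℝ} (h : IsTest τ φ) {t : ℝ} (ht : t ∉ Ioo 0 τ) : φ t = 0 :=
  image_eq_zero_of_notMem_tsupport fun h' => ht (h.tsupport_subset h')

theorem IsTest.continuous_deriv {φ : ℝ → ℝ} (h : IsTest τ φ) : Continuous (deriv φ) :=
  h.contDiff.continuous_deriv (by simp)

theorem IsTest.hasDerivAt {φ : ℝ → ℝ} (h : IsTest τ φ) (t : ℝ) : HasDerivAt φ (deriv φ t) t :=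
  (h.contDiff.differentiable (by simp) t).hasDerivAt

theorem IsTest.integrable_smul {φ : ℝ → ℝ} (h : IsTest τ φ) {p : ℝ → X}
    (hp : Integrable p (vol τ)) : Integrable (fun t => φ t • p t) (vol τ) := by
  obtain ⟨C, hC⟩ := h.hasCompactSupport.exists_bound_of_continuous h.contDiff.continuous
  exact hp.bdd_smul C h.contDiff.continuous.aestronglyMeasurable (.of_forall hC)

theorem IsTest.integrable_deriv_smul {φ : ℝ → ℝ} (h : IsTest τ φ) {p : ℝ → X}
    (hp : Integrable p (vol τ)) : Integrable (fun t => deriv φ t • p t) (vol τ) := by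
  obtain ⟨C, hC⟩ := h.hasCompactSupport.deriv.exists_bound_of_continuous h.continuous_deriv
  exact hp.bdd_smul C h.continuous_deriv.aestronglyMeasurable (.of_forall hC)

/-- Integration by parts of a test function against a primitive. -/
theorem IsTest.integral_deriv_smul_primitive [CompleteSpace X] (hτ : 0 < τ) {φ : ℝ → ℝ} (h : IsTest τ φ)
    {p : ℝ → X} (hp : Integrable p (vol τ)) :
    ∫ t, deriv φ t • (∫ s in 0..t, p s) ∂(vol τ) = - ∫ t, φ t • p t ∂(vol τ) := by
  have hφ : ∀ t, ∫ s in 0..t, deriv φ s = φ t := fun t => by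
    rw [intervalIntegral.integral_eq_sub_of_hasDerivAt (fun s _ => h.hasDerivAt s)
      (h.continuous_deriv.intervalIntegrable _ _), h.apply_eq_zero (t := 0) (by simp), sub_zero]
  have hd : IntegrableOn (deriv φ) (Ioc 0 τ) := h.continuous_deriv.integrableOn_Ioc
  have key := bilin_primitive_sub (ContinuousLinearMap.lsmul ℝ ℝ (E := X)) hτ.le hd
    (integrableOn_Ioc_of_vol hp) 0 0
  simp only [hφ, zero_add, ContinuousLinearMap.lsmul_apply, smul_zero, sub_zero] at key
  rw [h.apply_eq_zero (t := τ) (by simp), zero_smul, ← integral_vol hτ, integral_add] at key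
  · exact eq_neg_of_add_eq_zero_left key.symm
  · have := integrableOn_bilin_continuousOn ((ContinuousLinearMap.lsmul ℝ ℝ (E := X)).flip)
      (continuousOn_primitive_Icc (integrableOn_Ioc_of_vol hp)) hd
    exact (integrableOn_Ioc_iff_integrableOn_Ioo (by simp)).1 this
  · exact h.integrable_smul hp

/-- A test function with integral zero is the derivative of a test function. -/
theorem IsTest.exists_primitive {φ : ℝ → ℝ} (h : IsTest τ φ) (hτ : 0 < τ)
    (h0 : ∫ t, φ t ∂(vol τ) = 0) : ∃ ψ, IsTest τ ψ ∧ ∀ t, deriv ψ t = φ t := by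
  have hc := h.contDiff.continuous
  have hd : ∀ t, HasDerivAt (fun t => ∫ s in 0..t, φ s) (φ t) t := fun t =>
    intervalIntegral.integral_hasDerivAt_right (hc.intervalIntegrable _ _)
      (hc.stronglyMeasurableAtFilter _ _) hc.continuousAt
  have hd' : deriv (fun t => ∫ s in 0..t, φ s) = φ := funext fun t => (hd t).deriv
  have hcd : ContDiff ℝ ∞ (fun t => ∫ s in 0..t, φ s) := by
    rw [contDiff_infty_iff_deriv, hd']
    exact ⟨fun t => (hd t).differentiableAt, h.contDiff⟩
  -- the support of `φ` is contained in a compact subinterval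
  obtain ⟨a, b, ha, hb, hab⟩ : ∃ a b, 0 < a ∧ b < τ ∧ tsupport φ ⊆ Icc a b := by
    have hK : IsCompact (tsupport φ) := h.hasCompactSupport
    rcases (tsupport φ).eq_empty_or_nonempty with he | hne
    · exact ⟨τ / 2, τ / 2, by linarith, by linarith, by simp [he]⟩
    · obtain ⟨a, ha, ha'⟩ := hK.exists_isLeast hne
      obtain ⟨b, hb, hb'⟩ := hK.exists_isGreatest hne
      exact ⟨a, b, (h.tsupport_subset ha).1, (h.tsupport_subset hb).2,
        fun t ht => ⟨ha' ht, hb' ht⟩⟩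
  have hz : ∀ t, t ∉ Icc a b → φ t = 0 := fun t ht =>
    image_eq_zero_of_notMem_tsupport fun h' => ht (hab h')
  have hint : ∫ s in 0..τ, φ s = 0 := by rw [← integral_vol hτ, h0]
  have hs : ∀ t, t ∉ Icc a b → ∫ s in 0..t, φ s = 0 := by
    intro t ht
    rcases lt_or_ge t a with h1 | h1
    · rw [intervalIntegral.integral_congr (g := fun _ => 0), intervalIntegral.integral_zero]
      intro s hs
      refine hz s fun hs' => ?_
      have := hs.2
      have h3 := max_lt ha h1
      linarith [hs'.1]
    · have h2 : b < t := not_le.1 fun h2 => ht ⟨h1, h2⟩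
      rw [← intervalIntegral.integral_add_adjacent_intervals (b := τ)
        (hc.intervalIntegrable _ _) (hc.intervalIntegrable _ _), hint, zero_add,
        intervalIntegral.integral_congr (g := fun _ => 0), intervalIntegral.integral_zero]
      intro s hs
      refine hz s fun hs' => ?_
      have := hs.1
      have h3 := lt_min hb h2
      linarith [hs'.2]
  have hsupp : tsupport (fun t => ∫ s in 0..t, φ s) ⊆ Icc a b :=
    closure_minimal (fun t ht => by_contra fun h' => ht (hs t h')) isClosed_Icc
  exact ⟨_, ⟨hcd, isCompact_Icc.of_isClosed_subset (isClosed_tsupport _) hsupp,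
    hsupp.trans fun t ht => ⟨ha.trans_le ht.1, ht.2.trans_lt hb⟩⟩, fun t => (hd t).deriv⟩

theorem exists_isTest_integral_eq_one (hτ : 0 < τ) : ∃ φ, IsTest τ φ ∧ ∫ t, φ t ∂(vol τ) = 1 := by
  let f : ContDiffBump (τ / 2) := ⟨τ / 8, τ / 4, by linarith, by linarith⟩
  have hsupp : tsupport (f.normed volume) ⊆ Ioo 0 τ := by
    rw [f.tsupport_normed_eq, Real.closedBall_eq_Icc]
    intro t ht
    have h1 : τ / 2 - τ / 4 ≤ t := ht.1
    have h2 : t ≤ τ / 2 + τ / 4 := ht.2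
    constructor <;> linarith
  refine ⟨f.normed volume, ⟨f.contDiff_normed, f.hasCompactSupport_normed, hsupp⟩, ?_⟩
  rw [setIntegral_eq_integral_of_forall_compl_eq_zero fun t ht => ?_, f.integral_normed]
  exact image_eq_zero_of_notMem_tsupport fun h' => ht (hsupp h')

/-- The lemma of du Bois-Reymond: a function with an integrable weak derivative is the primitive
of its weak derivative. -/
theorem exists_ae_eq_primitive [CompleteSpace X] (hτ : 0 < τ) {u p : ℝ → X}
    (hu : Integrable u (vol τ)) (hp : Integrable p (vol τ)) (h : ∀ φ, IsTest τ φ →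
      ∫ t, deriv φ t • u t ∂(vol τ) = - ∫ t, φ t • p t ∂(vol τ)) :
    ∃ C : X, ∀ᵐ t ∂(vol τ), u t = C + ∫ s in 0..t, p s := by
  obtain ⟨φ₀, hφ₀, h1⟩ := exists_isTest_integral_eq_one hτ
  have hP : Integrable (fun t => ∫ s in 0..t, p s) (vol τ) :=
    ((continuousOn_primitive_Icc (integrableOn_Ioc_of_vol hp)).integrableOn_compact
      isCompact_Icc).mono_set Ioo_subset_Icc_self
  set F := fun t => u t - ∫ s in 0..t, p s with hF
  have hFi : Integrable F (vol τ) := hu.sub hP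
  have hF0 : ∀ φ, IsTest τ φ → ∫ t, deriv φ t • F t ∂(vol τ) = 0 := by
    intro φ hφ
    simp only [hF, smul_sub]
    rw [integral_sub (hφ.integrable_deriv_smul hu) (hφ.integrable_deriv_smul hP), h φ hφ,
      hφ.integral_deriv_smul_primitive hτ hp, sub_self]
  set C := ∫ t, φ₀ t • F t ∂(vol τ)
  refine ⟨C, ?_⟩
  have hC : Integrable (fun t => F t - C) (vol τ) := hFi.sub (integrable_const C)
  have key := isOpen_Ioo.ae_eq_zero_of_integral_contDiff_smul_eq_zero (U := Ioo 0 τ)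
    (f := fun t => F t - C) (μ := volume) (IntegrableOn.locallyIntegrableOn hC) ?_
  · rw [ae_restrict_iff' measurableSet_Ioo]
    filter_upwards [key] with t ht ht'
    have := ht ht'
    rw [sub_eq_zero, hF, sub_eq_iff_eq_add] at this
    exact this
  · intro ψ hψ1 hψ2 hψ3
    have hψ : IsTest τ ψ := ⟨hψ1, hψ2, hψ3⟩
    have i1 : Integrable ψ (vol τ) :=
      (hψ1.continuous.integrable_of_hasCompactSupport hψ2).integrableOn
    have i0 : Integrable φ₀ (vol τ) := (hφ₀.contDiff.continuous.integrable_of_hasCompactSupport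
      hφ₀.hasCompactSupport).integrableOn
    -- Subtracting `m φ₀` makes the mean of `ψ` vanish; the result is the derivative of a test
    -- function and is annihilated by `F`, so `∫ ψ F = m C`.
    set m := ∫ t, ψ t ∂(vol τ)
    have hχ : IsTest τ (fun t => ψ t - m * φ₀ t) := by
      refine ⟨hψ1.sub (contDiff_const.mul hφ₀.contDiff), hψ2.sub hφ₀.hasCompactSupport.mul_left, ?_⟩
      refine (tsupport_sub _ _).trans (union_subset hψ3 ?_)
      exact (tsupport_mul_subset_right).trans hφ₀.tsupport_subset
    obtain ⟨χ, hχt, hχd⟩ := hχ.exists_primitive hτ (by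
      rw [integral_sub i1 (i0.const_mul m), integral_const_mul, h1, mul_one, sub_self])
    have e := hF0 χ hχt
    simp only [hχd, sub_smul, mul_smul] at e
    rw [integral_sub (hψ.integrable_smul hFi) (by exact (hφ₀.integrable_smul hFi).smul m),
      integral_smul] at e
    rw [← setIntegral_eq_integral_of_forall_compl_eq_zero (s := Ioo 0 τ)
      fun t ht => by rw [hψ.apply_eq_zero ht, zero_smul]]
    simp only [smul_sub]
    rw [integral_sub (hψ.integrable_smul hFi) (i1.smul_const C), integral_smul_const]
    exact e

end TestFunctions

/-! ### Smoothing by resolvents of `ι† ι` -/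

section Gram

open Filter Topology
open scoped InnerProductSpace

variable {V H : Type*} [NormedAddCommGroup V] [InnerProductSpace ℝ V] [CompleteSpace V]
  [NormedAddCommGroup H] [InnerProductSpace ℝ H] [CompleteSpace H]

/-- The operator `ι† ι` on `V`. -/
def gram (ι : V →L[ℝ] H) : V →L[ℝ] V := ι.adjoint ∘L ι

theorem inner_gram_left (ι : V →L[ℝ] H) (v w : V) : ⟪gram ι v, w⟫_ℝ = ⟪ι v, ι w⟫_ℝ :=
  ContinuousLinearMap.adjoint_inner_left ι w (ι v)

theorem inner_gram_right (ι : V →L[ℝ] H) (v w : V) : ⟪v, gram ι w⟫_ℝ = ⟪ι v, ι w⟫_ℝ :=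
  ContinuousLinearMap.adjoint_inner_right ι v (ι w)

/-- A vector `v` orthogonal to the range satisfies `‖ι v‖² = ⟪ι† ι v, v⟫ = 0`. -/
theorem dense_range_gram {ι : V →L[ℝ] H} (hι : Function.Injective ι) : DenseRange (gram ι) := by
  have h : (gram ι).rangeᗮ = ⊥ := by
    rw [Submodule.eq_bot_iff]
    intro v hv
    have h1 := (Submodule.mem_orthogonal _ _).1 hv (gram ι v) ⟨v, rfl⟩
    rw [inner_gram_left, inner_self_eq_zero] at h1
    exact hι (by rw [h1, map_zero])
  have h2 := Submodule.topologicalClosure_eq_top_iff.2 h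
  intro x
  have : x ∈ ((gram ι).range.topologicalClosure : Set V) := by rw [h2]; trivial
  rwa [Submodule.topologicalClosure_coe, LinearMap.coe_range] at this

/-- Lax-Milgram: since `ι† ι` is nonnegative, `ε + ι† ι` is coercive with constant `ε`. -/
theorem exists_resolvent_gram (ι : V →L[ℝ] H) {ε : ℝ} (hε : 0 < ε) :
    ∃ S : V →L[ℝ] V, (∀ v, ε • S v + gram ι (S v) = v) ∧ ∀ v, S (ε • v + gram ι v) = v := by
  let A : V →L[ℝ] V := ε • ContinuousLinearMap.id ℝ V + gram ι
  have hA : ∀ v, A v = ε • v + gram ι v := fun v => rfl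
  let B : V →L[ℝ] V →L[ℝ] ℝ := (innerSL ℝ).comp A
  have hB : IsCoercive B := by
    refine ⟨ε, hε, fun v => ?_⟩
    change _ ≤ ⟪A v, v⟫_ℝ
    rw [hA, inner_add_left, real_inner_smul_left, inner_gram_left, real_inner_self_eq_norm_mul_norm,
      real_inner_self_eq_norm_sq]
    nlinarith [sq_nonneg ‖ι v‖]
  let e := hB.continuousLinearEquivOfBilin
  have he : ∀ v, e v = ε • v + gram ι v := fun v => by
    refine ext_inner_right ℝ fun w => ?_
    rw [hB.continuousLinearEquivOfBilin_apply, ← hA]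
    rfl
  exact ⟨e.symm, fun v => by rw [← he]; exact e.apply_symm_apply v,
    fun v => by rw [← he]; exact e.symm_apply_apply v⟩

/-- Operators `Sₙ` on `V` commuting with `ι† ι`, such that the contractions `Sₙ ι† ι` converge
strongly to the identity. -/
theorem exists_smoothing {ι : V →L[ℝ] H} (hι : Function.Injective ι) :
    ∃ S : ℕ → V →L[ℝ] V, (∀ n v, gram ι (S n v) = S n (gram ι v)) ∧
      (∀ n v, ‖S n (gram ι v)‖ ≤ ‖v‖) ∧
      ∀ v, Tendsto (fun n => S n (gram ι v)) atTop (𝓝 v) := by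
  have hpos : ∀ n : ℕ, (0 : ℝ) < 1 / ((n : ℝ) + 1) := fun n => Nat.one_div_pos_of_nat
  choose S hS1 hS2 using fun n => exists_resolvent_gram ι (hpos n)
  have hcomm : ∀ n v, gram ι (S n v) = S n (gram ι v) := by
    intro n v
    rw [← hS2 n (gram ι (S n v)), ← map_smul, ← map_add, hS1]
  have hle : ∀ n v, ‖S n (gram ι v)‖ ≤ ‖v‖ := by
    intro n v
    set y := S n (gram ι v)
    -- Pairing `ε y = ι† ι (v - y)` with `v - y` gives `ε ⟪v - y, y⟫ = ‖ι (v - y)‖² ≥ 0`, hence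
    -- `‖y‖² ≤ ⟪v, y⟫`.
    have h1 : (1 / ((n : ℝ) + 1)) • y = gram ι (v - y) := by
      rw [map_sub, eq_sub_iff_add_eq]
      exact hS1 n _
    have h2 : 0 ≤ (1 / ((n : ℝ) + 1)) * ⟪v - y, y⟫_ℝ := by
      rw [← real_inner_smul_right, h1, inner_gram_right]
      exact real_inner_self_nonneg
    have h3 : 0 ≤ ⟪v - y, y⟫_ℝ := nonneg_of_mul_nonneg_right h2 (hpos n)
    rw [inner_sub_left, real_inner_self_eq_norm_mul_norm] at h3
    have h4 := real_inner_le_norm v y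
    by_contra! h5
    have := norm_nonneg v
    nlinarith
  refine ⟨S, hcomm, hle, fun v => ?_⟩
  -- On the range of `ι† ι` the error is exactly `-ε Sₙ ι† ι y`, of norm at most `ε ‖y‖`. Density of
  -- the range and the contraction bound extend the convergence to all of `V`.
  have hrange : ∀ y, Tendsto (fun n => S n (gram ι (gram ι y))) atTop (𝓝 (gram ι y)) := by
    intro y
    rw [tendsto_iff_norm_sub_tendsto_zero]
    refine squeeze_zero (g := fun n : ℕ => 1 / ((n : ℝ) + 1) * ‖y‖) (fun _ => norm_nonneg _)
      (fun n => ?_) ?_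
    · have : S n (gram ι (gram ι y)) - gram ι y = - ((1 / ((n : ℝ) + 1)) • S n (gram ι y)) := by
        rw [sub_eq_iff_eq_add, ← hcomm, ← sub_eq_neg_add, eq_sub_iff_add_eq, add_comm]
        exact hS1 n _
      rw [this, norm_neg, norm_smul, Real.norm_of_nonneg (hpos n).le]
      gcongr
      exact hle n y
    · simpa using tendsto_one_div_add_atTop_nhds_zero_nat.mul_const ‖y‖
  rw [Metric.tendsto_atTop]
  intro δ hδ
  obtain ⟨y, hy⟩ := (dense_range_gram hι).exists_dist_lt v (ε := δ / 3) (by positivity)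
  obtain ⟨N, hN⟩ := Metric.tendsto_atTop.1 (hrange y) (δ / 3) (by positivity)
  refine ⟨N, fun n hn => ?_⟩
  have h1 : dist (S n (gram ι v)) (S n (gram ι (gram ι y))) < δ / 3 := by
    rw [dist_eq_norm, ← map_sub, ← map_sub]
    exact (hle n _).trans_lt (by rwa [← dist_eq_norm])
  have h2 := hN n hn
  have h3 := dist_triangle4 (S n (gram ι v)) (S n (gram ι (gram ι y))) (gram ι y) v
  rw [dist_comm] at hy
  linarith

end Gram

/-! ### Continuous representative in `H` and energy identity -/

section Regularity

open Filter Topology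
open scoped InnerProductSpace

variable {V H : Type*} [NormedAddCommGroup V] [InnerProductSpace ℝ V] [CompleteSpace V]
  [NormedAddCommGroup H] [InnerProductSpace ℝ H] [CompleteSpace H] {τ : ℝ}

theorem integrable_of_memLp_two {E : Type*} [NormedAddCommGroup E] {u : ℝ → E}
    (hu : MemLp u 2 (vol τ)) : Integrable u (vol τ) :=
  hu.integrable (by norm_num)

theorem continuousOn_const_add_primitive {X : Type*} [NormedAddCommGroup X] [NormedSpace ℝ X]
    {p : ℝ → X} (hp : MemLp p 2 (vol τ)) (C : X) :
    ContinuousOn (fun t => C + ∫ s in 0..t, p s) (Icc 0 τ) :=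
  continuousOn_const.add
    (continuousOn_primitive_Icc (integrableOn_Ioc_of_vol (integrable_of_memLp_two hp)))

/-- The energy identity after smoothing. -/
theorem norm_sq_map_primitive_sub (ι : V →L[ℝ] H) {D : V →L[ℝ] V}
    (hD : ∀ v, gram ι (D v) = D (gram ι v)) {p : ℝ → V} (hp : MemLp p 2 (vol τ)) (C : V)
    {t : ℝ} (ht : t ∈ Icc 0 τ) :
    ‖ι (D (C + ∫ s in 0..t, p s))‖ ^ 2 - ‖ι (D C)‖ ^ 2 =
      2 * ∫ r in 0..t, ⟪D (gram ι (p r)), D (C + ∫ s in 0..r, p s)⟫_ℝ := by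
  have hpi : IntegrableOn p (Ioc 0 t) :=
    (integrableOn_Ioc_of_vol (integrable_of_memLp_two hp)).mono_set (Ioc_subset_Ioc_right ht.2)
  have hDp : ∀ r ∈ Icc 0 t, ∫ s in 0..r, D (p s) = D (∫ s in 0..r, p s) := by
    intro r hr
    refine D.intervalIntegral_comp_comm ?_
    exact (intervalIntegrable_iff_integrableOn_Ioc_of_le hr.1).2
      (hpi.mono_set (Ioc_subset_Ioc_right hr.2))
  have key := bilin_primitive_sub ((innerSL ℝ).bilinearComp ι ι) ht.1
    (D.integrable_comp hpi) (D.integrable_comp hpi) (D C) (D C)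
  rw [hDp t ⟨ht.1, le_rfl⟩, ← map_add] at key
  change ⟪ι _, ι _⟫_ℝ - ⟪ι _, ι _⟫_ℝ = _ at key
  rw [real_inner_self_eq_norm_sq, real_inner_self_eq_norm_sq] at key
  rw [key, ← intervalIntegral.integral_const_mul]
  refine intervalIntegral.integral_congr fun r hr => ?_
  rw [uIcc_of_le ht.1] at hr
  -- Commutation puts `D` outside `ι† ι`: later only the products `D ι† ι` are uniformly bounded,
  -- not `D` itself.
  rw [hDp r hr, ← map_add, ← hD, inner_gram_left]
  change ⟪ι _, ι _⟫_ℝ + ⟪ι _, ι _⟫_ℝ = _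
  rw [real_inner_comm (ι (D (p r)))]
  ring

theorem integrable_norm_sq_of_memLp {E : Type*} [NormedAddCommGroup E] {u : ℝ → E}
    (hu : MemLp u 2 (vol τ)) :
    Integrable (fun t => ‖u t‖ ^ 2) (vol τ) :=
  (memLp_two_iff_integrable_sq_norm hu.1).1 hu

theorem integrable_inner_of_memLp {E : Type*} [NormedAddCommGroup E] [InnerProductSpace ℝ E]
    {u p : ℝ → E} (hu : MemLp u 2 (vol τ))
    (hp : MemLp p 2 (vol τ)) : Integrable (fun t => ⟪p t, u t⟫_ℝ) (vol τ) := by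
  refine Integrable.mono' ((integrable_norm_sq_of_memLp hu).add (integrable_norm_sq_of_memLp hp))
    (hp.1.inner hu.1) (.of_forall fun t => ?_)
  refine (norm_inner_le_norm _ _).trans ?_
  simp only [Pi.add_apply]
  nlinarith [sq_nonneg (‖u t‖ - ‖p t‖), sq_nonneg ‖u t‖, sq_nonneg ‖p t‖]

/-- A uniform bound in `H` by the norm in the maximal regularity space, after smoothing. -/
theorem norm_sq_map_primitive_le (ι : V →L[ℝ] H) (hτ : 0 < τ) {D : V →L[ℝ] V}
    (hD : ∀ v, gram ι (D v) = D (gram ι v)) {u p : ℝ → V} (hu : MemLp u 2 (vol τ))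
    (hp : MemLp p 2 (vol τ)) {C : V} (hW : ∀ᵐ t ∂(vol τ), gram ι (u t) = C + ∫ s in 0..t, p s)
    {t : ℝ} (ht : t ∈ Icc 0 τ) :
    ‖ι (D (C + ∫ s in 0..t, p s))‖ ^ 2 ≤
      (‖ι‖ ^ 2 / τ + 2) * ∫ r, (‖D (gram ι (p r))‖ ^ 2 + ‖D (gram ι (u r))‖ ^ 2) ∂(vol τ) := by
  set W := fun t => C + ∫ s in 0..t, p s with hWdef
  have hWc : ContinuousOn W (Icc 0 τ) := continuousOn_const_add_primitive hp C
  have i1 : Integrable (fun r => ‖D (gram ι (p r))‖ ^ 2) (vol τ) :=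
    integrable_norm_sq_of_memLp ((D ∘L gram ι).comp_memLp' hp)
  have i2 : Integrable (fun r => ‖D (gram ι (u r))‖ ^ 2) (vol τ) :=
    integrable_norm_sq_of_memLp ((D ∘L gram ι).comp_memLp' hu)
  set B := ∫ r, (‖D (gram ι (p r))‖ ^ 2 + ‖D (gram ι (u r))‖ ^ 2) ∂(vol τ) with hB
  -- Every value is within `B` of the value at `0`, so any two differ by at most `2B`. The value at
  -- `t` therefore exceeds the mean over `(0, τ)` by at most `2B`, and the mean is at most `‖ι‖² B /
  -- τ`.
  have hosc : ∀ t ∈ Icc 0 τ, |‖ι (D (W t))‖ ^ 2 - ‖ι (D C)‖ ^ 2| ≤ B := by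
    intro t ht
    rw [hWdef, norm_sq_map_primitive_sub ι hD hp C ht, ← intervalIntegral.integral_const_mul,
      ← Real.norm_eq_abs]
    refine (intervalIntegral.norm_integral_le_integral_norm ht.1).trans ?_
    rw [intervalIntegral.integral_of_le ht.1, integral_Ioc_eq_integral_Ioo]
    have hmono : ∫ r in Ioo 0 t, (‖D (gram ι (p r))‖ ^ 2 + ‖D (gram ι (u r))‖ ^ 2) ≤ B :=
      setIntegral_mono_set (i1.add i2) (.of_forall fun r => by
        simp only [Pi.zero_apply]; positivity) (Ioo_subset_Ioo_right ht.2).eventuallyLE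
    refine le_trans (integral_mono_of_nonneg (.of_forall fun r => norm_nonneg _)
      ((i1.add i2).mono_measure (Measure.restrict_mono_set _ (Ioo_subset_Ioo_right ht.2))) ?_) hmono
    have hW' := ae_restrict_of_ae_restrict_of_subset (Ioo_subset_Ioo_right ht.2) hW
    filter_upwards [hW'] with r hr
    rw [← hr, norm_mul, Real.norm_of_nonneg zero_le_two]
    have := norm_inner_le_norm (𝕜 := ℝ) (D (gram ι (p r))) (D (gram ι (u r)))
    simp only [Pi.add_apply]
    nlinarith [sq_nonneg (‖D (gram ι (p r))‖ - ‖D (gram ι (u r))‖)]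
  have hqc : ContinuousOn (fun t => ‖ι (D (W t))‖ ^ 2) (Icc 0 τ) :=
    ((ι.continuous.comp D.continuous).comp_continuousOn hWc).norm.pow 2
  have hqi : Integrable (fun t => ‖ι (D (W t))‖ ^ 2) (vol τ) :=
    (hqc.integrableOn_compact isCompact_Icc).mono_set Ioo_subset_Icc_self
  have h1 : τ * (‖ι (D (W t))‖ ^ 2 - 2 * B) ≤ ∫ s, ‖ι (D (W s))‖ ^ 2 ∂(vol τ) := by
    have : ∫ s, (‖ι (D (W t))‖ ^ 2 - 2 * B) ∂(vol τ) = τ * (‖ι (D (W t))‖ ^ 2 - 2 * B) := by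
      rw [integral_const]
      simp [Measure.real, hτ.le]
    rw [← this]
    refine setIntegral_mono_on (integrable_const _) hqi measurableSet_Ioo fun s hs => ?_
    have h1 := abs_le.1 (hosc t ht)
    have h2 := abs_le.1 (hosc s (Ioo_subset_Icc_self hs))
    linarith [h1.2, h2.1]
  have h2 : ∫ s, ‖ι (D (W s))‖ ^ 2 ∂(vol τ) ≤ ‖ι‖ ^ 2 * B := by
    rw [hB, ← integral_const_mul]
    refine integral_mono_ae hqi ((i1.add i2).const_mul _) ?_
    filter_upwards [hW] with s hs
    simp only [hWdef]
    rw [← hs]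
    have := ι.le_opNorm (D (gram ι (u s)))
    calc _ ≤ (‖ι‖ * ‖D (gram ι (u s))‖) ^ 2 := by gcongr
      _ = ‖ι‖ ^ 2 * ‖D (gram ι (u s))‖ ^ 2 := by ring
      _ ≤ _ := by gcongr; simp only [le_add_iff_nonneg_left]; positivity
  have h3 : ‖ι (D (W t))‖ ^ 2 - 2 * B ≤ ‖ι‖ ^ 2 * B / τ := by
    rw [le_div_iff₀ hτ]; linarith
  calc ‖ι (D (W t))‖ ^ 2 ≤ ‖ι‖ ^ 2 * B / τ + 2 * B := by linarith
    _ = _ := by ring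

theorem tendsto_integral_norm_sq_sub {E : Type*} [NormedAddCommGroup E]
    [InnerProductSpace ℝ E] {T : ℕ → E →L[ℝ] E} (hT : ∀ n v, ‖T n v‖ ≤ ‖v‖)
    (hlim : ∀ v, Tendsto (fun n => T n v) atTop (𝓝 v)) {u : ℝ → E} (hu : MemLp u 2 (vol τ)) :
    Tendsto (fun n => ∫ t, ‖T n (u t) - u t‖ ^ 2 ∂(vol τ)) atTop (𝓝 0) := by
  have := tendsto_integral_of_dominated_convergence (μ := vol τ)
    (F := fun n t => ‖T n (u t) - u t‖ ^ 2) (f := fun _ => 0) (fun t => 4 * ‖u t‖ ^ 2)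
    (fun n => (((T n).continuous.comp_aestronglyMeasurable hu.1).sub hu.1).norm.pow 2)
    ((integrable_norm_sq_of_memLp hu).const_mul 4) (fun n => .of_forall fun t => ?_)
    (.of_forall fun t => ?_)
  · simpa using this
  · rw [norm_pow, norm_norm]
    have := (norm_sub_le (T n (u t)) (u t)).trans (add_le_add_left (hT n (u t)) _)
    calc _ ≤ (‖u t‖ + ‖u t‖) ^ 2 := by gcongr
      _ = _ := by ring
  · have := ((hlim (u t)).sub_const (u t)).norm.pow 2
    simpa using this

/-- The continuous representative in `H` of a function in the maximal regularity space, and its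
energy identity. -/
theorem exists_continuousOn_rep {ι : V →L[ℝ] H} (hι : Function.Injective ι) (hτ : 0 < τ)
    {u p : ℝ → V} (hu : MemLp u 2 (vol τ)) (hp : MemLp p 2 (vol τ)) {C : V}
    (hW : ∀ᵐ t ∂(vol τ), gram ι (u t) = C + ∫ s in 0..t, p s) :
    ∃ c : ℝ → H, ContinuousOn c (Icc 0 τ) ∧ (∀ᵐ t ∂(vol τ), c t = ι (u t)) ∧
      (∀ t ∈ Icc 0 τ, ‖c t‖ ^ 2 - ‖c 0‖ ^ 2 = 2 * ∫ r in 0..t, ⟪p r, u r⟫_ℝ) ∧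
      ∀ t ∈ Icc 0 τ, ∀ w, ⟪c t, ι w⟫_ℝ = ⟪C + ∫ s in 0..t, p s, w⟫_ℝ := by
  obtain ⟨S, hS1, hS2, hS3⟩ := exists_smoothing hι
  set W := fun t => C + ∫ s in 0..t, p s with hWdef
  have hWc : ContinuousOn W (Icc 0 τ) := continuousOn_const_add_primitive hp C
  let T : ℕ → V →L[ℝ] V := fun n => S n ∘L gram ι
  set δ : ℕ → ℝ := fun n => (∫ t, ‖S n (gram ι (p t)) - p t‖ ^ 2 ∂(vol τ)) +
    ∫ t, ‖S n (gram ι (u t)) - u t‖ ^ 2 ∂(vol τ) with hδ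
  have hδ0 : Tendsto δ atTop (𝓝 0) := by
    rw [← add_zero (0 : ℝ)]
    exact (tendsto_integral_norm_sq_sub (T := T) hS2 hS3 hp).add
      (tendsto_integral_norm_sq_sub (T := T) hS2 hS3 hu)
  set A := ‖ι‖ ^ 2 / τ + 2
  have hA0 : 0 ≤ A := by positivity
  have hid : ∀ n {x : ℝ → V}, MemLp x 2 (vol τ) →
      Integrable (fun t => ‖S n (gram ι (x t)) - x t‖ ^ 2) (vol τ) := fun n x hx =>
    integrable_norm_sq_of_memLp (((S n ∘L gram ι).comp_memLp' hx).sub hx)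
  -- The difference `Sₙ - Sₘ` also commutes with `ι† ι`, so the uniform estimate applies to it; its
  -- `L²` norms are compared with `δ` by inserting the identity.
  have hbound : ∀ n m, ∀ t ∈ Icc 0 τ,
      ‖ι (S n (W t)) - ι (S m (W t))‖ ^ 2 ≤ A * (2 * (δ n + δ m)) := by
    intro n m t ht
    have hD : ∀ v, gram ι ((S n - S m) v) = (S n - S m) (gram ι v) := by
      intro v; simp [hS1]
    have h1 := norm_sq_map_primitive_le ι hτ hD hu hp hW ht
    rw [sub_apply, map_sub] at h1
    refine h1.trans ?_
    gcongr
    have hpt : ∀ x : V, ‖(S n - S m) (gram ι x)‖ ^ 2 ≤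
        2 * (‖S n (gram ι x) - x‖ ^ 2 + ‖S m (gram ι x) - x‖ ^ 2) := by
      intro x
      have : (S n - S m) (gram ι x) = (S n (gram ι x) - x) - (S m (gram ι x) - x) := by
        rw [sub_apply]; abel
      rw [this]
      have h2 := norm_sub_le (S n (gram ι x) - x) (S m (gram ι x) - x)
      calc _ ≤ (‖S n (gram ι x) - x‖ + ‖S m (gram ι x) - x‖) ^ 2 := by gcongr
        _ ≤ _ := add_sq_le
    have heq : 2 * (δ n + δ m) = ∫ t,
        (2 * (‖S n (gram ι (p t)) - p t‖ ^ 2 + ‖S m (gram ι (p t)) - p t‖ ^ 2) +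
          2 * (‖S n (gram ι (u t)) - u t‖ ^ 2 + ‖S m (gram ι (u t)) - u t‖ ^ 2)) ∂(vol τ) := by
      rw [integral_add (by exact ((hid n hp).add (hid m hp)).const_mul 2)
        (by exact ((hid n hu).add (hid m hu)).const_mul 2), integral_const_mul, integral_const_mul,
        integral_add (hid n hp) (hid m hp), integral_add (hid n hu) (hid m hu), hδ]
      ring
    rw [heq]
    refine integral_mono
      ((integrable_norm_sq_of_memLp (((S n - S m) ∘L gram ι).comp_memLp' hp)).add
        (integrable_norm_sq_of_memLp (((S n - S m) ∘L gram ι).comp_memLp' hu)))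
      ((((hid n hp).add (hid m hp)).const_mul 2).add (((hid n hu).add (hid m hu)).const_mul 2))
      fun t => add_le_add (hpt _) (hpt _)
  have hcauchy : UniformCauchySeqOn (fun n t => ι (S n (W t))) atTop (Icc 0 τ) := by
    rw [Metric.uniformCauchySeqOn_iff]
    intro ε hε
    have h0 : Tendsto (fun n => A * (4 * δ n)) atTop (𝓝 0) := by
      simpa using (hδ0.const_mul 4).const_mul A
    obtain ⟨N, hN⟩ := eventually_atTop.1 (h0.eventually_lt_const (show 0 < ε ^ 2 by positivity))
    refine ⟨N, fun m hm n hn t ht => ?_⟩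
    rw [dist_eq_norm]
    refine lt_of_pow_lt_pow_left₀ 2 hε.le ((hbound m n t ht).trans_lt ?_)
    have h1 := hN m hm
    have h2 := hN n hn
    linarith
  have hex : ∀ t, ∃ x, t ∈ Icc 0 τ → Tendsto (fun n => ι (S n (W t))) atTop (𝓝 x) := by
    intro t
    by_cases ht : t ∈ Icc 0 τ
    · obtain ⟨x, hx⟩ := cauchySeq_tendsto_of_complete (hcauchy.cauchySeq ht)
      exact ⟨x, fun _ => hx⟩
    · exact ⟨0, fun h => absurd h ht⟩
  choose c hc using hex
  have hunif := hcauchy.tendstoUniformlyOn_of_tendsto hc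
  refine ⟨c, hunif.continuousOn (.of_forall fun n =>
    (ι.continuous.comp (S n).continuous).comp_continuousOn hWc), ?_, ?_, ?_⟩
  · filter_upwards [hW, ae_restrict_mem measurableSet_Ioo] with t ht htm
    refine tendsto_nhds_unique (hc t (Ioo_subset_Icc_self htm)) ?_
    simp only [hWdef]
    rw [← ht]
    exact (ι.continuous.tendsto _).comp (hS3 (u t))
  · intro t ht
    have h0 : (0 : ℝ) ∈ Icc 0 τ := ⟨le_rfl, hτ.le⟩
    have hl : Tendsto (fun n => ‖ι (S n (W t))‖ ^ 2 - ‖ι (S n (W 0))‖ ^ 2) atTop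
        (𝓝 (‖c t‖ ^ 2 - ‖c 0‖ ^ 2)) := ((hc t ht).norm.pow 2).sub ((hc 0 h0).norm.pow 2)
    refine tendsto_nhds_unique hl ?_
    have he : ∀ n, ‖ι (S n (W t))‖ ^ 2 - ‖ι (S n (W 0))‖ ^ 2 =
        2 * ∫ r in 0..t, ⟪S n (gram ι (p r)), S n (W r)⟫_ℝ := by
      intro n
      rw [← norm_sq_map_primitive_sub ι (hS1 n) hp C ht]
      simp [hWdef]
    simp only [he]
    refine Tendsto.const_mul 2 ?_
    have hsub : Ioc 0 t ⊆ Ioc 0 τ := Ioc_subset_Ioc_right ht.2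
    have hW' : ∀ᵐ r ∂volume.restrict (Ioc 0 t), gram ι (u r) = W r := by
      refine ae_restrict_of_ae_restrict_of_subset hsub ?_
      rwa [← restrict_Ioo_eq_restrict_Ioc]
    simp only [intervalIntegral.integral_of_le ht.1]
    have hm : ∀ {x : ℝ → V}, MemLp x 2 (vol τ) →
        AEStronglyMeasurable x (volume.restrict (Ioc 0 t)) := fun hx =>
      (integrableOn_Ioc_of_vol (integrable_of_memLp_two hx)).1.mono_measure
        (Measure.restrict_mono_set _ hsub)
    -- Almost everywhere `W = ι† ι u`, so both entries of the inner product have the form `Sₙ ι† ι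
    -- x`: they converge to `p` and `u` and are dominated by their norms.
    refine tendsto_integral_of_dominated_convergence (fun r => ‖p r‖ * ‖u r‖) (fun n => ?_) ?_
      (fun n => ?_) ?_
    · exact ((S n ∘L gram ι).continuous.comp_aestronglyMeasurable (hm hp)).inner
        (((S n).continuous.comp_continuousOn (hWc.mono
          (Ioc_subset_Icc_self.trans (Icc_subset_Icc_right ht.2)))).aestronglyMeasurable
            measurableSet_Ioc)
    · have : Integrable (fun r => ‖p r‖ * ‖u r‖) (vol τ) := by
        exact MemLp.integrable_mul hp.norm hu.norm
      exact (integrableOn_Ioc_of_vol this).mono_set hsub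
    · filter_upwards [hW'] with r hr
      rw [← hr]
      refine (norm_inner_le_norm _ _).trans ?_
      gcongr
      · exact hS2 n _
      · exact hS2 n _
    · filter_upwards [hW'] with r hr
      rw [← hr]
      exact (hS3 (p r)).inner (hS3 (u r))
  · intro t ht w
    have h1 : Tendsto (fun n => ⟪ι (S n (W t)), ι w⟫_ℝ) atTop (𝓝 ⟪c t, ι w⟫_ℝ) :=
      (hc t ht).inner tendsto_const_nhds
    refine tendsto_nhds_unique h1 ?_
    -- Now `⟪ι Sₙ W, ι w⟫ = ⟪Sₙ ι† ι W, w⟫`, whose limit is `⟪W, w⟫`. This ties `c` to the primitive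
    -- at every time, including `t = 0`.
    simp only [← inner_gram_left, hS1]
    exact (hS3 (W t)).inner tendsto_const_nhds

end Regularity

/-! ### Substituting measurable functions into Carathéodory functions -/

section Caratheodory

open Filter Topology

variable {α E : Type*} [MeasurableSpace α] {μ : Measure α} [TopologicalSpace E]

/-- A pointwise identity between Carathéodory functions extends from constant to strongly
measurable arguments. -/
theorem ae_apply_eq_zero {N : α → E → ℝ} (hN : ∀ᵐ t ∂μ, Continuous (N t))
    (h : ∀ w, ∀ᵐ t ∂μ, N t w = 0) [TopologicalSpace.PseudoMetrizableSpace E] {v : α → E}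
    (hv : AEStronglyMeasurable v μ) :
    ∀ᵐ t ∂μ, N t (v t) = 0 := by
  -- The range is separable up to a null set of times: countably many constants share one
  -- exceptional null set, and continuity reaches their closure.
  obtain ⟨c, hc, hcl⟩ := hv.stronglyMeasurable_mk.isSeparable_range
  have h1 : ∀ᵐ t ∂μ, ∀ w ∈ c, N t w = 0 := (ae_ball_iff hc).2 fun w _ => h w
  filter_upwards [hN, h1, hv.ae_eq_mk] with t ht1 ht2 ht3
  rw [ht3]
  have : closure c ⊆ {w | N t w = 0} :=
    closure_minimal ht2 (isClosed_eq ht1 continuous_const)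
  exact this (hcl (mem_range_self t))

/-- Approximation of `v` by simple functions: each takes finitely many values, so only finitely many
exceptional null sets arise, and continuity of `N t` gives the limit. -/
theorem aemeasurable_apply {N : α → E → ℝ} (hN : ∀ᵐ t ∂μ, Continuous (N t))
    (h : ∀ w, AEMeasurable (fun t => N t w) μ) [TopologicalSpace.PseudoMetrizableSpace E]
    {v : α → E} (hv : AEStronglyMeasurable v μ) : AEMeasurable (fun t => N t (v t)) μ := by
  have hs := hv.stronglyMeasurable_mk
  refine aemeasurable_of_tendsto_metrizable_ae atTop (f := fun n t => N t (hs.approx n t))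
    (fun n => ?_) ?_
  · refine ⟨fun t => (h (hs.approx n t)).mk _ t, ?_, ?_⟩
    · exact (hs.approx n).measurable_bind (fun w => (h w).mk _) fun w => (h w).measurable_mk
    · have : ∀ᵐ t ∂μ, ∀ w ∈ (hs.approx n).range, N t w = (h w).mk _ t :=
        (ae_ball_iff (Finset.countable_toSet _)).2 fun w _ => (h w).ae_eq_mk
      filter_upwards [this] with t ht
      exact ht _ (SimpleFunc.mem_range_self _ _)
  · filter_upwards [hN, hv.ae_eq_mk] with t ht1 ht2
    rw [ht2]
    exact (ht1.tendsto _).comp (hs.tendsto_approx t)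

end Caratheodory

/-! ### Real forms and their operators on `L²(0, τ; V)` -/

section RealForms

open Filter Topology
open scoped InnerProductSpace

variable {V H : Type*} [NormedAddCommGroup V] [InnerProductSpace ℝ V]
  [NormedAddCommGroup H] [InnerProductSpace ℝ H] {τ : ℝ}

/-- A real non-autonomous form: measurable in time, uniformly bounded, and quasi-coercive. -/
structure IsRealForm (ι : V →L[ℝ] H) (τ : ℝ) (b : ℝ → V →ₗ[ℝ] V →ₗ[ℝ] ℝ) : Prop where
  measurable : ∀ v w : V, AEMeasurable (fun t => b t v w) (vol τ)
  bounded : ∃ M : ℝ, 0 ≤ M ∧ ∀ t ∈ Ioo 0 τ, ∀ v w : V, |b t v w| ≤ M * ‖v‖ * ‖w‖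
  quasiCoercive : ∃ ω₀ α : ℝ, 0 < α ∧ ∀ t ∈ Ioo 0 τ, ∀ v : V,
    α * ‖v‖ ^ 2 ≤ b t v v + ω₀ * ‖ι v‖ ^ 2

/-- `p` is the weak derivative of `u` in the dual of `V`, which is identified with `V`. -/
def IsRealWeakDeriv (ι : V →L[ℝ] H) (τ : ℝ) (u p : ℝ → V) : Prop :=
  ∀ φ : ℝ → ℝ, IsTest τ φ → ∀ w : V,
    ∫ t, deriv φ t * ⟪ι w, ι (u t)⟫_ℝ ∂(vol τ) = - ∫ t, φ t * ⟪w, p t⟫_ℝ ∂(vol τ)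

/-- The weak form of `u' + 𝓑(·) u = F`, where the dual of `V` is identified with `V`. -/
def RealSolves (ι : V →L[ℝ] H) (τ : ℝ) (b : ℝ → V →ₗ[ℝ] V →ₗ[ℝ] ℝ) (F u : L2 τ V) : Prop :=
  ∃ p : L2 τ V, IsRealWeakDeriv ι τ u p ∧
    ∀ w : V, ∀ᵐ t ∂(vol τ), ⟪w, p t⟫_ℝ + b t (u t) w = ⟪w, F t⟫_ℝ

theorem IsRealForm.continuous {ι : V →L[ℝ] H} {b : ℝ → V →ₗ[ℝ] V →ₗ[ℝ] ℝ}
    (hb : IsRealForm ι τ b) {t : ℝ} (ht : t ∈ Ioo 0 τ) :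
    Continuous fun x : V × V => b t x.1 x.2 := by
  obtain ⟨M, -, hM⟩ := hb.bounded
  exact ((b t).mkContinuous₂ M (hM t ht)).continuous₂

theorem IsRealForm.ae_continuous {ι : V →L[ℝ] H} {b : ℝ → V →ₗ[ℝ] V →ₗ[ℝ] ℝ}
    (hb : IsRealForm ι τ b) : ∀ᵐ t ∂(vol τ), Continuous fun x : V × V => b t x.1 x.2 :=
  (ae_restrict_mem measurableSet_Ioo).mono fun _ => hb.continuous

theorem integrable_norm_mul_norm {E : Type*} [NormedAddCommGroup E] {u v : ℝ → E}
    (hu : MemLp u 2 (vol τ)) (hv : MemLp v 2 (vol τ)) :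
    Integrable (fun t => ‖u t‖ * ‖v t‖) (vol τ) :=
  MemLp.integrable_mul hu.norm hv.norm

theorem IsRealForm.integrable {ι : V →L[ℝ] H} {b : ℝ → V →ₗ[ℝ] V →ₗ[ℝ] ℝ}
    (hb : IsRealForm ι τ b) {u v : ℝ → V} (hu : MemLp u 2 (vol τ)) (hv : MemLp v 2 (vol τ)) :
    Integrable (fun t => b t (u t) (v t)) (vol τ) := by
  obtain ⟨M, -, hM⟩ := hb.bounded
  refine Integrable.mono' ((integrable_norm_mul_norm hu hv).const_mul M) ?_ ?_
  · exact (aemeasurable_apply (N := fun t (x : V × V) => b t x.1 x.2) hb.ae_continuous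
      (fun x => hb.measurable x.1 x.2) (hu.1.prodMk hv.1)).aestronglyMeasurable
  · filter_upwards [ae_restrict_mem measurableSet_Ioo] with t ht
    rw [← mul_assoc]
    exact hM t ht _ _

theorem integral_norm_mul_norm_le {E : Type*} [NormedAddCommGroup E] (u v : L2 τ E) :
    ∫ t, ‖u t‖ * ‖v t‖ ∂(vol τ) ≤ ‖u‖ * ‖v‖ := by
  have h : ∀ u : L2 τ E, ‖(Lp.memLp u).norm.toLp‖ = ‖u‖ := fun u => by
    rw [Lp.norm_toLp, eLpNorm_norm, Lp.norm_def]
  have key := real_inner_le_norm (Lp.memLp u).norm.toLp (Lp.memLp v).norm.toLp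
  rw [h, h, L2.inner_def] at key
  refine le_trans (le_of_eq (integral_congr_ae ?_)) key
  filter_upwards [(Lp.memLp u).norm.coeFn_toLp, (Lp.memLp v).norm.coeFn_toLp] with t h1 h2
  rw [h1, h2]
  simp [mul_comm]

/-- The operator `𝓑` on `L²(0, τ; V)` given by a form; it is obtained from the Riesz
representation in `L²(0, τ; V)`, since `t ↦ 𝓑(t) u(t)` is only weakly measurable. -/
theorem IsRealForm.exists_operator [CompleteSpace V] {ι : V →L[ℝ] H}
    {b : ℝ → V →ₗ[ℝ] V →ₗ[ℝ] ℝ} (hb : IsRealForm ι τ b) :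
    ∃ A : L2 τ V →L[ℝ] L2 τ V, (∀ u v, ⟪A u, v⟫_ℝ = ∫ t, b t (u t) (v t) ∂(vol τ)) ∧
      ∀ u, ∀ w : V, ∀ᵐ t ∂(vol τ), ⟪w, A u t⟫_ℝ = b t (u t) w := by
  obtain ⟨M, hM0, hM⟩ := hb.bounded
  have hi := fun u v : L2 τ V => hb.integrable (Lp.memLp u) (Lp.memLp v)
  let B : L2 τ V →ₗ[ℝ] L2 τ V →ₗ[ℝ] ℝ := LinearMap.mk₂ ℝ
    (fun u v => ∫ t, b t (u t) (v t) ∂(vol τ))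
    (fun u u' v => by
      rw [← integral_add (hi u v) (hi u' v)]
      refine integral_congr_ae ?_
      filter_upwards [Lp.coeFn_add u u'] with t ht
      rw [ht, Pi.add_apply, map_add, LinearMap.add_apply])
    (fun c u v => by
      rw [smul_eq_mul, ← integral_const_mul]
      refine integral_congr_ae ?_
      filter_upwards [Lp.coeFn_smul c u] with t ht
      rw [ht, Pi.smul_apply, map_smul, LinearMap.smul_apply, smul_eq_mul])
    (fun u v v' => by
      rw [← integral_add (hi u v) (hi u v')]
      refine integral_congr_ae ?_
      filter_upwards [Lp.coeFn_add v v'] with t ht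
      rw [ht, Pi.add_apply, map_add])
    (fun c u v => by
      rw [smul_eq_mul, ← integral_const_mul]
      refine integral_congr_ae ?_
      filter_upwards [Lp.coeFn_smul c v] with t ht
      rw [ht, Pi.smul_apply, map_smul, smul_eq_mul])
  have hB : ∀ u v, ‖B u v‖ ≤ M * ‖u‖ * ‖v‖ := by
    intro u v
    refine (norm_integral_le_integral_norm _).trans ?_
    rw [mul_assoc]
    refine le_trans ?_ (mul_le_mul_of_nonneg_left (integral_norm_mul_norm_le u v) hM0)
    rw [← integral_const_mul]
    refine integral_mono_ae (hi u v).norm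
      ((integrable_norm_mul_norm (Lp.memLp u) (Lp.memLp v)).const_mul M) ?_
    filter_upwards [ae_restrict_mem measurableSet_Ioo] with t ht
    rw [← mul_assoc]
    exact hM t ht _ _
  let A := InnerProductSpace.continuousLinearMapOfBilin (𝕜 := ℝ) (B.mkContinuous₂ M hB)
  have hA : ∀ u v, ⟪A u, v⟫_ℝ = ∫ t, b t (u t) (v t) ∂(vol τ) := fun u v =>
    InnerProductSpace.continuousLinearMapOfBilin_apply _ _ _
  refine ⟨A, hA, fun u w => ?_⟩
  -- Pairing `A u` with the indicator of `s` times `w` compares the integrals of both sides over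
  -- `s`.
  refine Integrable.ae_eq_of_forall_setIntegral_eq _ _
    ((integrable_of_memLp_two (Lp.memLp (A u))).const_inner w)
    (hb.integrable (Lp.memLp u) (memLp_const w)) fun s hs hs' => ?_
  rw [← L2.inner_indicatorConstLp_eq_setIntegral_inner ℝ (A u) hs w hs'.ne, real_inner_comm, hA,
    ← integral_indicator hs]
  refine integral_congr_ae ?_
  filter_upwards [indicatorConstLp_coeFn (p := 2) (hs := hs) (hμs := hs'.ne) (c := w)] with t ht
  rw [ht]
  by_cases h : t ∈ s <;> simp [h]

end RealForms

/-! ### Lions' theorem for the real initial value problem -/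

section RealProblem

open Filter Topology
open scoped InnerProductSpace

variable {V H : Type*} [NormedAddCommGroup V] [InnerProductSpace ℝ V] [CompleteSpace V]
  [NormedAddCommGroup H] [InnerProductSpace ℝ H] [CompleteSpace H] {τ : ℝ} {ι : V →L[ℝ] H}
  {b : ℝ → V →ₗ[ℝ] V →ₗ[ℝ] ℝ}

theorem IsRealWeakDeriv.exists_primitive (hτ : 0 < τ) {u p : ℝ → V} (hu : MemLp u 2 (vol τ))
    (hp : MemLp p 2 (vol τ)) (h : IsRealWeakDeriv ι τ u p) :
    ∃ C : V, ∀ᵐ t ∂(vol τ), gram ι (u t) = C + ∫ s in 0..t, p s := by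
  have hpi := integrable_of_memLp_two hp
  have hui : Integrable (fun t => gram ι (u t)) (vol τ) :=
    integrable_of_memLp_two ((gram ι).comp_memLp' hu)
  refine exists_ae_eq_primitive hτ hui hpi fun φ hφ => ext_inner_left ℝ fun w => ?_
  rw [inner_neg_right, ← integral_inner (hφ.integrable_deriv_smul hui),
    ← integral_inner (hφ.integrable_smul hpi)]
  simpa only [real_inner_smul_right, inner_gram_right] using h φ hφ w

/-- A function in the maximal regularity space has a continuous representative in `H`, which
satisfies the energy identity. -/
theorem IsRealWeakDeriv.exists_continuousOn (hι : Function.Injective ι) (hτ : 0 < τ) {u p : ℝ → V}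
    (hu : MemLp u 2 (vol τ)) (hp : MemLp p 2 (vol τ)) (h : IsRealWeakDeriv ι τ u p) :
    ∃ c : ℝ → H, ContinuousOn c (Icc 0 τ) ∧ (∀ᵐ t ∂(vol τ), c t = ι (u t)) ∧
      (∀ t ∈ Icc 0 τ, ‖c t‖ ^ 2 - ‖c 0‖ ^ 2 = 2 * ∫ r in 0..t, ⟪p r, u r⟫_ℝ) := by
  obtain ⟨C, hC⟩ := h.exists_primitive hτ hu hp
  obtain ⟨c, h1, h2, h3, -⟩ := exists_continuousOn_rep hι hτ hu hp hC
  exact ⟨c, h1, h2, h3⟩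

theorem eqOn_Icc_of_ae_eq {E : Type*} [NormedAddCommGroup E] (hτ : 0 < τ) {c d : ℝ → E}
    (hc : ContinuousOn c (Icc 0 τ)) (hd : ContinuousOn d (Icc 0 τ))
    (h : ∀ᵐ t ∂(vol τ), c t = d t) : EqOn c d (Icc 0 τ) := by
  refine Measure.eqOn_Icc_of_ae_eq volume hτ.ne ?_ hc hd
  rwa [← restrict_Ioo_eq_restrict_Icc]

/-- Grönwall's inequality in integral form, with vanishing initial value. -/
theorem eqOn_zero_of_le_integral {q : ℝ → ℝ} (hq : Continuous q) (hq0 : ∀ t, 0 ≤ q t)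
    {k : ℝ} (h : ∀ t ∈ Icc 0 τ, q t ≤ k * ∫ s in 0..t, q s) : ∀ t ∈ Icc 0 τ, q t = 0 := by
  have hQ : ∀ t, HasDerivAt (fun t => ∫ s in 0..t, q s) (q t) t := fun t =>
    intervalIntegral.integral_hasDerivAt_right (hq.intervalIntegrable _ _)
      (hq.stronglyMeasurableAtFilter _ _) hq.continuousAt
  have hz := eq_zero_of_abs_deriv_le_mul_abs_self_of_eq_zero_right (a := 0) (b := τ) (K := k)
    (f := fun t => ∫ s in 0..t, q s) (f' := q)
    (fun t _ => (hQ t).continuousAt.continuousWithinAt) (fun t _ => (hQ t).hasDerivWithinAt)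
    intervalIntegral.integral_same fun t ht => ?_
  · intro t ht
    refine le_antisymm ?_ (hq0 t)
    simpa [hz t ht] using h t ht
  · rw [Real.norm_of_nonneg (hq0 t), Real.norm_of_nonneg
      (intervalIntegral.integral_nonneg ht.1 fun s _ => hq0 s)]
    exact h t (Ico_subset_Icc_self ht)

/-- Uniqueness for the initial value problem. -/
theorem RealSolves.eq_zero (hb : IsRealForm ι τ b) (hι : Function.Injective ι) (hτ : 0 < τ)
    {u : L2 τ V} (h : RealSolves ι τ b 0 u) {c : ℝ → H} (hc : ContinuousOn c (Icc 0 τ))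
    (hcu : ∀ᵐ t ∂(vol τ), c t = ι (u t)) (h0 : c 0 = 0) : u = 0 := by
  obtain ⟨p, hp, he⟩ := h
  obtain ⟨ω₀, α, hα, hco⟩ := hb.quasiCoercive
  obtain ⟨d, hd, hdu, hen⟩ := hp.exists_continuousOn hι hτ (Lp.memLp u) (Lp.memLp p)
  have hdc : EqOn d c (Icc 0 τ) := eqOn_Icc_of_ae_eq hτ hd hc <| by
    filter_upwards [hcu, hdu] with t h1 h2 using h2.trans h1.symm
  have hd0 : d 0 = 0 := (hdc ⟨le_rfl, hτ.le⟩).trans h0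
  -- The null set in the tested equation depends on `w`, so `w = u t` is not a direct
  -- specialization; the Carathéodory argument supplies it.
  have hdiag : ∀ᵐ t ∂(vol τ), ⟪u t, p t⟫_ℝ + b t (u t) (u t) = 0 := by
    refine ae_apply_eq_zero (N := fun t w => ⟪w, p t⟫_ℝ + b t (u t) w) ?_ (fun w => ?_)
      (Lp.memLp u).1
    · filter_upwards [hb.ae_continuous] with t ht
      exact (continuous_id.inner continuous_const).add
        (ht.comp (continuous_const.prodMk continuous_id))
    · filter_upwards [he w, Lp.coeFn_zero V 2 (vol τ)] with t h1 h2
      rw [h1, h2, Pi.zero_apply, inner_zero_right]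
  -- Projecting the time to `[0, τ]` extends `‖d‖²` continuously to all of `ℝ`, as Grönwall's
  -- inequality is stated for such functions.
  set q : ℝ → ℝ := fun t => ‖d (projIcc 0 τ hτ.le t)‖ ^ 2 with hq
  have hqc : Continuous q :=
    (((continuousOn_iff_continuous_domRestrict.1 hd).comp continuous_projIcc).norm.pow 2)
  have hqd : ∀ t ∈ Icc 0 τ, q t = ‖d t‖ ^ 2 := fun t ht => by
    rw [hq]; simp only [projIcc_of_mem hτ.le ht]
  have hz := eqOn_zero_of_le_integral (τ := τ) hqc (fun t => by positivity) (k := 2 * |ω₀|) ?_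
  · rw [Lp.eq_zero_iff_ae_eq_zero]
    filter_upwards [hdu, ae_restrict_mem measurableSet_Ioo] with t ht1 ht2
    have h1 := hz t (Ioo_subset_Icc_self ht2)
    rw [hqd t (Ioo_subset_Icc_self ht2), ht1] at h1
    refine hι ?_
    rw [Pi.zero_apply, map_zero]
    simpa using h1
  · intro t ht
    have h1 := hen t ht
    rw [hd0, norm_zero, zero_pow two_ne_zero, sub_zero] at h1
    rw [hqd t ht, h1, mul_assoc]
    refine mul_le_mul_of_nonneg_left ?_ (zero_le_two (α := ℝ))
    rw [← intervalIntegral.integral_const_mul]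
    have hsub : Ioc 0 t ⊆ Ioc 0 τ := Ioc_subset_Ioc_right ht.2
    rw [intervalIntegral.integral_of_le ht.1, intervalIntegral.integral_of_le ht.1]
    refine integral_mono_ae ((integrableOn_Ioc_of_vol (integrable_inner_of_memLp (Lp.memLp u)
      (Lp.memLp p))).mono_set hsub) (hqc.const_mul _).integrableOn_Ioc ?_
    refine ae_restrict_of_ae_restrict_of_subset hsub ?_
    rw [← restrict_Ioo_eq_restrict_Ioc]
    filter_upwards [hdiag, hdu, ae_restrict_mem measurableSet_Ioo] with r h2 h3 h4
    rw [hqd r (Ioo_subset_Icc_self h4), h3, real_inner_comm]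
    have h5 := hco r h4 (u r)
    have h6 : ω₀ * ‖ι (u r)‖ ^ 2 ≤ |ω₀| * ‖ι (u r)‖ ^ 2 :=
      mul_le_mul_of_nonneg_right (le_abs_self _) (by positivity)
    have h7 : 0 ≤ α * ‖u r‖ ^ 2 := by positivity
    linarith

/-- A form of the Lax-Milgram-Lions representation lemma. -/
theorem exists_inner_eq_of_bounded {X E : Type*} [AddCommGroup X] [Module ℝ X]
    [NormedAddCommGroup E] [InnerProductSpace ℝ E] [CompleteSpace E] (Λ : X →ₗ[ℝ] E)
    (F : X →ₗ[ℝ] ℝ) {K : ℝ} (hK : ∀ ψ, |F ψ| ≤ K * ‖Λ ψ‖) : ∃ u : E, ∀ ψ, ⟪u, Λ ψ⟫_ℝ = F ψ := by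
  -- The bound forces `F` to vanish on the kernel of `Λ`, so `F ∘ s` does not depend on the section
  -- `s`. It is bounded on the range of `Λ`; Hahn-Banach and Riesz finish.
  obtain ⟨s, hs⟩ := Λ.rangeRestrict.exists_rightInverse_of_surjective Λ.range_rangeRestrict
  have hs' : ∀ y, Λ (s y) = y := fun y => congrArg Subtype.val (LinearMap.congr_fun hs y)
  let ℓ : StrongDual ℝ Λ.range := (F ∘ₗ s).mkContinuous K fun y => by
    have := hK (s y)
    rwa [hs'] at this
  obtain ⟨g, hg, -⟩ := exists_extension_norm_eq (𝕜 := ℝ) Λ.range ℓ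
  refine ⟨(InnerProductSpace.toDual ℝ E).symm g, fun ψ => ?_⟩
  rw [InnerProductSpace.toDual_symm_apply]
  have h1 := hg (Λ.rangeRestrict ψ)
  have h2 : F (s (Λ.rangeRestrict ψ)) = F ψ := by
    rw [← sub_eq_zero, ← map_sub, ← abs_nonpos_iff]
    refine (hK _).trans (le_of_eq ?_)
    rw [map_sub, hs', LinearMap.codRestrict_apply, sub_self, norm_zero, mul_zero]
  rw [← h2]
  exact h1

theorem memLp_of_continuous {E : Type*} [NormedAddCommGroup E] {ψ : ℝ → E} (h : Continuous ψ) :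
    MemLp ψ 2 (vol τ) := by
  obtain ⟨C, hC⟩ := isCompact_Icc.exists_bound_of_continuousOn (h.continuousOn (s := Icc 0 τ))
  refine MemLp.of_bound h.aestronglyMeasurable C ?_
  filter_upwards [ae_restrict_mem measurableSet_Ioo] with t ht
  exact hC t (Ioo_subset_Icc_self ht)

theorem integrable_mul_inner {E : Type*} [NormedAddCommGroup E] [InnerProductSpace ℝ E]
    {m : ℝ → ℝ} (hm : Continuous m) (w : E) {f : ℝ → E} (hf : MemLp f 2 (vol τ)) :
    Integrable (fun t => m t * ⟪w, f t⟫_ℝ) (vol τ) := by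
  have hc : Continuous fun t => m t • w := by fun_prop
  simpa only [real_inner_smul_left] using integrable_inner_of_memLp hf (memLp_of_continuous hc)

/-- Continuous functions as elements of `L²(0, τ; E)`. -/
def toL2 {E : Type*} [NormedAddCommGroup E] (τ : ℝ) {ψ : ℝ → E} (h : Continuous ψ) : L2 τ E :=
  (memLp_of_continuous h).toLp ψ

theorem coeFn_toL2 {E : Type*} [NormedAddCommGroup E] {ψ : ℝ → E} (h : Continuous ψ) :
    ∀ᵐ t ∂(vol τ), toL2 τ h t = ψ t := MemLp.coeFn_toLp _

/-- The `C¹` functions vanishing at `τ`, the test functions for the initial value problem. -/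
def finalTest (V : Type*) [NormedAddCommGroup V] [InnerProductSpace ℝ V] (τ : ℝ) :
    Submodule ℝ (ℝ → V) where
  carrier := {ψ | ContDiff ℝ 1 ψ ∧ ψ τ = 0}
  add_mem' := fun ha hb => ⟨ha.1.add hb.1, by simp [ha.2, hb.2]⟩
  zero_mem' := ⟨contDiff_const, rfl⟩
  smul_mem' := fun c _ ha => ⟨ha.1.const_smul c, by simp [ha.2]⟩

theorem finalTest.continuous {E : Type*} [NormedAddCommGroup E]
    [InnerProductSpace ℝ E] (ψ : finalTest E τ) : Continuous ψ.1 := ψ.2.1.continuous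

theorem finalTest.continuous_deriv {E : Type*} [NormedAddCommGroup E]
    [InnerProductSpace ℝ E] (ψ : finalTest E τ) : Continuous (deriv ψ.1) :=
  ψ.2.1.continuous_deriv le_rfl

theorem finalTest.hasDerivAt {E : Type*} [NormedAddCommGroup E]
    [InnerProductSpace ℝ E] (ψ : finalTest E τ) (t : ℝ) : HasDerivAt ψ.1 (deriv ψ.1 t) t :=
  (ψ.2.1.differentiable one_ne_zero t).hasDerivAt

/-- The inclusion of the test functions into `L²(0, τ; V)`. -/
def finalTestToL2 (V : Type*) [NormedAddCommGroup V] [InnerProductSpace ℝ V] (τ : ℝ) :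
    finalTest V τ →ₗ[ℝ] L2 τ V where
  toFun ψ := toL2 τ (finalTest.continuous ψ)
  map_add' _ _ := rfl
  map_smul' _ _ := rfl

/-- The derivative of the test functions, in `L²(0, τ; V)`. -/
def finalTestDeriv (V : Type*) [NormedAddCommGroup V] [InnerProductSpace ℝ V] (τ : ℝ) :
    finalTest V τ →ₗ[ℝ] L2 τ V where
  toFun ψ := toL2 τ (finalTest.continuous_deriv ψ)
  map_add' ψ χ := by
    refine Eq.trans ?_ (MemLp.toLp_add (memLp_of_continuous (finalTest.continuous_deriv ψ))
      (memLp_of_continuous (finalTest.continuous_deriv χ)))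
    refine MemLp.toLp_congr _ _ (.of_forall fun t => ?_)
    exact ((finalTest.hasDerivAt ψ t).add (finalTest.hasDerivAt χ t)).deriv
  map_smul' r ψ := by
    refine Eq.trans ?_ (MemLp.toLp_const_smul r
      (memLp_of_continuous (finalTest.continuous_deriv ψ)))
    refine MemLp.toLp_congr _ _ (.of_forall fun t => ?_)
    exact ((finalTest.hasDerivAt ψ t).const_smul r).deriv

/-- Integrate the derivative of `e^{2kt} ‖ι ψ‖²`; the boundary term at `τ` vanishes. With `k = |ω₀|`
the extra term compensates the `H`-norm in quasi-coercivity. -/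
theorem finalTest.integral_exp_mul {V H : Type*} [NormedAddCommGroup V] [InnerProductSpace ℝ V]
    [NormedAddCommGroup H] [InnerProductSpace ℝ H] (hτ : 0 < τ) (ι : V →L[ℝ] H) (k : ℝ)
    (ψ : finalTest V τ) :
    - ∫ t, Real.exp (2 * k * t) * ⟪ι (deriv ψ.1 t), ι (ψ.1 t)⟫_ℝ ∂(vol τ) =
      (∫ t, Real.exp (2 * k * t) * (k * ‖ι (ψ.1 t)‖ ^ 2) ∂(vol τ)) + ‖ι (ψ.1 0)‖ ^ 2 / 2 := by
  have hd : ∀ t, HasDerivAt (fun t => Real.exp (2 * k * t) * ‖ι (ψ.1 t)‖ ^ 2)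
      (2 * (Real.exp (2 * k * t) * (k * ‖ι (ψ.1 t)‖ ^ 2) +
        Real.exp (2 * k * t) * ⟪ι (deriv ψ.1 t), ι (ψ.1 t)⟫_ℝ)) t := by
    intro t
    have h1 : HasDerivAt (fun t => ι (ψ.1 t)) (ι (deriv ψ.1 t)) t :=
      ι.hasFDerivAt.comp_hasDerivAt t (finalTest.hasDerivAt ψ t)
    have h2 : HasDerivAt (fun t => Real.exp (2 * k * t)) (Real.exp (2 * k * t) * (2 * k)) t := by
      simpa using ((hasDerivAt_id t).const_mul (2 * k)).exp
    refine (h2.mul h1.norm_sq).congr_deriv ?_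
    rw [real_inner_comm]
    ring
  have hc1 : Continuous fun t => Real.exp (2 * k * t) * (k * ‖ι (ψ.1 t)‖ ^ 2) := by
    have := finalTest.continuous ψ
    fun_prop
  have hc2 : Continuous fun t => Real.exp (2 * k * t) * ⟪ι (deriv ψ.1 t), ι (ψ.1 t)⟫_ℝ := by
    have := finalTest.continuous ψ
    have := finalTest.continuous_deriv ψ
    fun_prop
  have key := intervalIntegral.integral_eq_sub_of_hasDerivAt (a := 0) (b := τ) (fun t _ => hd t)
    (((hc1.add hc2).const_mul 2).intervalIntegrable _ _)
  rw [intervalIntegral.integral_const_mul, intervalIntegral.integral_add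
    (hc1.intervalIntegrable _ _) (hc2.intervalIntegrable _ _), ψ.2.2] at key
  rw [integral_vol hτ, integral_vol hτ]
  simp only [map_zero, norm_zero, mul_zero, Real.exp_zero, one_mul] at key
  linarith

/-- Existence for the initial value problem (J.-L. Lions). -/
theorem exists_realSolves (hb : IsRealForm ι τ b) (hι : Function.Injective ι)
    (hdense : DenseRange ι) (hτ : 0 < τ) (F : L2 τ V) (x : H) :
    ∃ u : L2 τ V, RealSolves ι τ b F u ∧ ∃ c : ℝ → H, ContinuousOn c (Icc 0 τ) ∧
      (∀ᵐ t ∂(vol τ), c t = ι (u t)) ∧ c 0 = x := by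
  obtain ⟨A, hA, hAw⟩ := hb.exists_operator
  obtain ⟨ω₀, α, hα, hco⟩ := hb.quasiCoercive
  let E₀ := finalTestToL2 V τ
  let E₁ := finalTestDeriv V τ
  have hE₀ : ∀ ψ, ∀ᵐ t ∂(vol τ), E₀ ψ t = ψ.1 t := fun ψ =>
    coeFn_toL2 (finalTest.continuous ψ)
  have hE₁ : ∀ ψ, ∀ᵐ t ∂(vol τ), E₁ ψ t = deriv ψ.1 t := fun ψ =>
    coeFn_toL2 (finalTest.continuous_deriv ψ)
  -- The formal adjoint of `u ↦ u' + 𝓑u`, namely `ψ ↦ 𝓑*ψ - ι† ι ψ'`.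
  let Λ : finalTest V τ →ₗ[ℝ] L2 τ V :=
    A.adjoint.toLinearMap ∘ₗ E₀ - ((gram ι).compLpL 2 (vol τ)).toLinearMap ∘ₗ E₁
  have hΛ : ∀ ψ (u : L2 τ V), ⟪u, Λ ψ⟫_ℝ =
      (∫ t, b t (u t) (ψ.1 t) ∂(vol τ)) - ∫ t, ⟪ι (deriv ψ.1 t), ι (u t)⟫_ℝ ∂(vol τ) := by
    intro ψ u
    have h1 : Λ ψ = A.adjoint (E₀ ψ) - (gram ι).compLpL 2 (vol τ) (E₁ ψ) := rfl
    rw [h1, inner_sub_right, ContinuousLinearMap.adjoint_inner_right, hA, L2.inner_def]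
    congr 1
    · refine integral_congr_ae ?_
      filter_upwards [hE₀ ψ] with t ht
      rw [ht]
    · refine integral_congr_ae ?_
      filter_upwards [hE₁ ψ, (gram ι).coeFn_compLpL (E₁ ψ)] with t h1 h2
      rw [h2, h1, inner_gram_right, real_inner_comm]
  have hcoer : ∀ ψ, α * ‖E₀ ψ‖ ^ 2 + ‖ι (ψ.1 0)‖ ^ 2 / 2 ≤
      ‖Λ ψ‖ * (Real.exp (2 * |ω₀| * τ) * ‖E₀ ψ‖) := by
    intro ψ
    have hψ := finalTest.continuous ψ
    -- Coercivity comes from pairing `Λ ψ` with the weighted function `e^{2|ω₀|t} ψ` instead of `ψ`.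
    have hec : Continuous fun t => Real.exp (2 * |ω₀| * t) • ψ.1 t := by fun_prop
    have hbi : Integrable (fun t => Real.exp (2 * |ω₀| * t) * b t (ψ.1 t) (ψ.1 t)) (vol τ) := by
      have := hb.integrable (memLp_of_continuous hec) (memLp_of_continuous hψ)
      simpa using this
    have hki : Integrable (fun t => Real.exp (2 * |ω₀| * t) * (|ω₀| * ‖ι (ψ.1 t)‖ ^ 2))
        (vol τ) := by
      have hc : Continuous fun t => Real.exp (2 * |ω₀| * t) * (|ω₀| * ‖ι (ψ.1 t)‖ ^ 2) := by
        fun_prop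
      exact integrable_of_memLp_two (memLp_of_continuous hc)
    have h1 : ‖toL2 τ hec‖ ≤ Real.exp (2 * |ω₀| * τ) * ‖E₀ ψ‖ := by
      refine Lp.norm_le_mul_norm_of_ae_le_mul ?_
      filter_upwards [hE₀ ψ, coeFn_toL2 (τ := τ) hec, ae_restrict_mem measurableSet_Ioo]
        with t h1 h2 h3
      rw [h1, h2, norm_smul, Real.norm_of_nonneg (Real.exp_pos _).le]
      have := h3.2.le
      gcongr
    have h2 : ⟪toL2 τ hec, Λ ψ⟫_ℝ ≤ ‖Λ ψ‖ * (Real.exp (2 * |ω₀| * τ) * ‖E₀ ψ‖) := by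
      refine (real_inner_le_norm _ _).trans ?_
      rw [mul_comm]
      gcongr
    refine le_trans ?_ h2
    have h3 : ∫ t, b t (toL2 τ hec t) (ψ.1 t) ∂(vol τ) =
        ∫ t, Real.exp (2 * |ω₀| * t) * b t (ψ.1 t) (ψ.1 t) ∂(vol τ) := by
      refine integral_congr_ae ?_
      filter_upwards [coeFn_toL2 (τ := τ) hec] with t h2
      simp [h2]
    have h4 : ∫ t, ⟪ι (deriv ψ.1 t), ι (toL2 τ hec t)⟫_ℝ ∂(vol τ) =
        ∫ t, Real.exp (2 * |ω₀| * t) * ⟪ι (deriv ψ.1 t), ι (ψ.1 t)⟫_ℝ ∂(vol τ) := by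
      refine integral_congr_ae ?_
      filter_upwards [coeFn_toL2 (τ := τ) hec] with t h2
      rw [h2, map_smul, real_inner_smul_right]
    rw [hΛ, h3, h4, sub_eq_add_neg, finalTest.integral_exp_mul hτ, ← add_assoc,
      ← integral_add hbi hki]
    gcongr
    have h5 : ‖E₀ ψ‖ ^ 2 = ∫ t, ‖ψ.1 t‖ ^ 2 ∂(vol τ) := by
      rw [← real_inner_self_eq_norm_sq, L2.inner_def]
      refine integral_congr_ae ?_
      filter_upwards [hE₀ ψ] with t ht
      rw [ht, real_inner_self_eq_norm_sq]
    rw [h5, ← integral_const_mul]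
    refine integral_mono_ae
      ((integrable_norm_sq_of_memLp (memLp_of_continuous hψ)).const_mul α) (hbi.add hki) ?_
    filter_upwards [ae_restrict_mem measurableSet_Ioo] with t ht
    have h6 := hco t ht (ψ.1 t)
    have h7 : ω₀ * ‖ι (ψ.1 t)‖ ^ 2 ≤ |ω₀| * ‖ι (ψ.1 t)‖ ^ 2 :=
      mul_le_mul_of_nonneg_right (le_abs_self _) (by positivity)
    have h8 : 1 ≤ Real.exp (2 * |ω₀| * t) :=
      Real.one_le_exp (by have := ht.1.le; positivity)
    have h9 : 0 ≤ α * ‖ψ.1 t‖ ^ 2 := by positivity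
    calc α * ‖ψ.1 t‖ ^ 2 ≤ Real.exp (2 * |ω₀| * t) * (α * ‖ψ.1 t‖ ^ 2) :=
          le_mul_of_one_le_left h9 h8
      _ ≤ Real.exp (2 * |ω₀| * t) * (b t (ψ.1 t) (ψ.1 t) + |ω₀| * ‖ι (ψ.1 t)‖ ^ 2) := by
          gcongr; linarith
      _ = _ := by rw [mul_add]
  -- The right-hand side after integration by parts: the initial value enters as the boundary term
  -- at `0`.
  let G : finalTest V τ →ₗ[ℝ] ℝ :=
    (innerSL ℝ F).toLinearMap ∘ₗ E₀ +
      (innerSL ℝ x).toLinearMap ∘ₗ ι.toLinearMap ∘ₗ LinearMap.proj 0 ∘ₗ (finalTest V τ).subtype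
  have hG : ∀ ψ, G ψ = ⟪F, E₀ ψ⟫_ℝ + ⟪x, ι (ψ.1 0)⟫_ℝ := fun ψ => rfl
  have hbdd : ∃ K, ∀ ψ, |G ψ| ≤ K * ‖Λ ψ‖ := by
    set e := Real.exp (2 * |ω₀| * τ)
    have he0 : 0 < e := Real.exp_pos _
    -- Coercivity first gives `‖ψ‖ ≤ (e/α) ‖Λψ‖` in `L²`; reinserted, it bounds `‖ι ψ(0)‖²` by
    -- `(2e²/α) ‖Λψ‖²`, and the cruder `4e²/α` has a convenient root.
    refine ⟨‖F‖ * (e / α) + ‖x‖ * (2 * e / Real.sqrt α), fun ψ => ?_⟩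
    have h1 := hcoer ψ
    have h2 : ‖E₀ ψ‖ ≤ e / α * ‖Λ ψ‖ := by
      rw [div_mul_eq_mul_div, le_div_iff₀ hα]
      rcases (norm_nonneg (E₀ ψ)).eq_or_lt with h0 | h0
      · rw [← h0, zero_mul]; positivity
      · refine le_of_mul_le_mul_right ?_ h0
        nlinarith [sq_nonneg ‖ι (ψ.1 0)‖]
    have h3 : ‖ι (ψ.1 0)‖ ≤ 2 * e / Real.sqrt α * ‖Λ ψ‖ := by
      refine le_of_sq_le_sq ?_ (by positivity)
      rw [mul_pow, div_pow, Real.sq_sqrt hα.le]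
      have h4 : ‖Λ ψ‖ * (e * ‖E₀ ψ‖) ≤ ‖Λ ψ‖ * (e * (e / α * ‖Λ ψ‖)) := by gcongr
      have h5 : 0 ≤ α * ‖E₀ ψ‖ ^ 2 := by positivity
      have h6 : (2 * e) ^ 2 / α * ‖Λ ψ‖ ^ 2 = 4 * (‖Λ ψ‖ * (e * (e / α * ‖Λ ψ‖))) := by ring
      rw [h6]
      nlinarith [sq_nonneg ‖ι (ψ.1 0)‖]
    rw [hG]
    refine (abs_add_le _ _).trans ?_
    have h4 := abs_real_inner_le_norm F (E₀ ψ)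
    have h5 := abs_real_inner_le_norm x (ι (ψ.1 0))
    have h6 : ‖F‖ * ‖E₀ ψ‖ ≤ ‖F‖ * (e / α * ‖Λ ψ‖) := by gcongr
    have h7 : ‖x‖ * ‖ι (ψ.1 0)‖ ≤ ‖x‖ * (2 * e / Real.sqrt α * ‖Λ ψ‖) := by gcongr
    calc _ ≤ ‖F‖ * (e / α * ‖Λ ψ‖) + ‖x‖ * (2 * e / Real.sqrt α * ‖Λ ψ‖) := by linarith
      _ = _ := by ring
  obtain ⟨K, hK⟩ := hbdd
  obtain ⟨u, hu⟩ := exists_inner_eq_of_bounded Λ G hK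
  have hpcoe : ∀ᵐ t ∂(vol τ), (F - A u) t = F t - A u t := Lp.coeFn_sub _ _
  have hFi := integrable_of_memLp_two (Lp.memLp F)
  have hAi := integrable_of_memLp_two (Lp.memLp (A u))
  -- Testing with `m(t) w`: functions with `m(0) = 0` yield the weak derivative, the choice `m(t) =
  -- τ - t` the initial value.
  have hmain : ∀ (m : ℝ → ℝ), ContDiff ℝ 1 m → m τ = 0 → ∀ w : V,
      ∫ t, deriv m t * ⟪ι w, ι (u t)⟫_ℝ ∂(vol τ) =
        - (∫ t, m t * ⟪w, (F - A u) t⟫_ℝ ∂(vol τ)) - m 0 * ⟪x, ι w⟫_ℝ := by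
    intro m hm hm0 w
    have hmc := hm.continuous
    let ψ : finalTest V τ := ⟨fun t => m t • w, hm.smul contDiff_const, by simp [hm0]⟩
    have hψd : ∀ t, deriv ψ.1 t = deriv m t • w := fun t =>
      (((hm.differentiable one_ne_zero t).hasDerivAt).smul_const w).deriv
    have h1 := hu ψ
    rw [hΛ, hG] at h1
    have h2 : ∫ t, b t (u t) (ψ.1 t) ∂(vol τ) = ∫ t, m t * ⟪w, A u t⟫_ℝ ∂(vol τ) := by
      refine integral_congr_ae ?_
      filter_upwards [hAw u w] with t ht
      rw [ht]
      exact map_smul _ _ _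
    have h3 : ∫ t, ⟪ι (deriv ψ.1 t), ι (u t)⟫_ℝ ∂(vol τ) =
        ∫ t, deriv m t * ⟪ι w, ι (u t)⟫_ℝ ∂(vol τ) := by
      simp only [hψd, map_smul, real_inner_smul_left]
    have h4 : ⟪F, E₀ ψ⟫_ℝ = ∫ t, m t * ⟪w, F t⟫_ℝ ∂(vol τ) := by
      rw [L2.inner_def]
      refine integral_congr_ae ?_
      filter_upwards [hE₀ ψ] with t ht
      rw [ht, real_inner_comm, real_inner_smul_left]
    have hmul : ∀ f : L2 τ V, Integrable (fun t => m t * ⟪w, f t⟫_ℝ) (vol τ) := fun f =>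
      integrable_mul_inner hmc w (Lp.memLp f)
    have h5 : ∫ t, m t * ⟪w, (F - A u) t⟫_ℝ ∂(vol τ) =
        (∫ t, m t * ⟪w, F t⟫_ℝ ∂(vol τ)) - ∫ t, m t * ⟪w, A u t⟫_ℝ ∂(vol τ) := by
      rw [← integral_sub (hmul F) (hmul (A u))]
      refine integral_congr_ae ?_
      filter_upwards [hpcoe] with t ht
      rw [ht, inner_sub_right, mul_sub]
    have h6 : ⟪x, ι (ψ.1 0)⟫_ℝ = m 0 * ⟪x, ι w⟫_ℝ := by
      simp only [ψ, map_smul, real_inner_smul_right]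
    rw [h2, h3, h4, h6] at h1
    rw [h5]
    linarith
  have hwd : IsRealWeakDeriv ι τ u (F - A u : L2 τ V) := by
    intro φ hφ w
    have := hmain φ (hφ.contDiff.of_le (by simp)) (hφ.apply_eq_zero (by simp)) w
    rwa [hφ.apply_eq_zero (t := 0) (by simp), zero_mul, sub_zero] at this
  refine ⟨u, ⟨F - A u, hwd, fun w => ?_⟩, ?_⟩
  · filter_upwards [hpcoe, hAw u w] with t h1 h2
    rw [h1, inner_sub_right, h2, sub_add_cancel]
  · have hpL := Lp.memLp (F - A u)
    obtain ⟨C, hC⟩ := hwd.exists_primitive hτ (Lp.memLp u) hpL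
    obtain ⟨c, hc1, hc2, -, hc4⟩ := exists_continuousOn_rep hι hτ (Lp.memLp u) hpL hC
    refine ⟨c, hc1, hc2, ?_⟩
    refine hdense.eq_of_inner_left ℝ fun w => ?_
    have h1 : ⟪c 0, ι w⟫_ℝ = ⟪w, C⟫_ℝ := by
      rw [hc4 0 ⟨le_rfl, hτ.le⟩, intervalIntegral.integral_same, add_zero, real_inner_comm]
    have hpi := integrable_of_memLp_two hpL
    have hwi : Integrable (fun t => ⟪w, (F - A u) t⟫_ℝ) (vol τ) := hpi.const_inner w
    -- The product rule for `τ - t` and `⟪w, C + ∫ p⟫` has boundary term `-τ ⟪w, C⟫`; the weak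
    -- equation has `-τ ⟪x, ι w⟫` in its place.
    have h2 := bilin_primitive_sub (ContinuousLinearMap.mul ℝ ℝ) hτ.le
      (p := fun _ => (-1 : ℝ)) (integrableOn_const (by simp)) (integrableOn_Ioc_of_vol hwi)
      τ ⟪w, C⟫_ℝ
    have h3 := hmain (fun t => τ - t) (by fun_prop) (sub_self τ) w
    have h4 : ∫ t in 0..τ, (-1 * (⟪w, C⟫_ℝ + ∫ s in 0..t, ⟪w, (F - A u) s⟫_ℝ) +
        (τ - t) * ⟪w, (F - A u) t⟫_ℝ) = - (∫ t, ⟪ι w, ι (u t)⟫_ℝ ∂(vol τ)) +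
          ∫ t, (τ - t) * ⟪w, (F - A u) t⟫_ℝ ∂(vol τ) := by
      rw [← integral_vol hτ, ← integral_neg, ← integral_add]
      · refine integral_congr_ae ?_
        filter_upwards [hC, ae_restrict_mem measurableSet_Ioo] with t h5 h6
        have h7 : ∫ s in 0..t, ⟪w, (F - A u) s⟫_ℝ = ⟪w, ∫ s in 0..t, (F - A u) s⟫_ℝ := by
          rw [intervalIntegral.integral_of_le h6.1.le, intervalIntegral.integral_of_le h6.1.le]
          exact integral_inner
            ((integrableOn_Ioc_of_vol hpi).mono_set (Ioc_subset_Ioc_right h6.2.le)) w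
        rw [h7, ← inner_add_right, ← h5, inner_gram_right, neg_one_mul]
      · exact ((integrable_of_memLp_two (ι.comp_memLp' (Lp.memLp u))).const_inner _).neg
      · exact integrable_mul_inner (by fun_prop) w hpL
    have h5 : ∀ t : ℝ, τ + ∫ _ in 0..t, (-1 : ℝ) = τ - t := fun t => by
      rw [intervalIntegral.integral_const, smul_eq_mul]; ring
    simp only [ContinuousLinearMap.mul_apply', h5, sub_self, zero_mul] at h2
    have h6 : ∀ t, deriv (fun t => τ - t) t = -1 := fun t => by simp
    simp only [h6, neg_one_mul, integral_neg, sub_zero] at h3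
    rw [h4] at h2
    rw [h1]
    refine mul_left_cancel₀ hτ.ne' ?_
    linarith

end RealProblem

/-! ### The antidual and real parts of functionals -/

section AntiDual

variable {𝕜 V H : Type*} [RCLike 𝕜]
  [NormedAddCommGroup V] [InnerProductSpace 𝕜 V]
  [NormedAddCommGroup H] [InnerProductSpace 𝕜 H]

/-- The real part of the evaluation of antilinear functionals at `w`. -/
def evalRe (𝕜 : Type*) [RCLike 𝕜] [InnerProductSpace 𝕜 V] (w : V) : AntiDual 𝕜 V →L[ℝ] ℝ :=
  LinearMap.mkContinuous
    { toFun := fun ℓ => RCLike.re (ℓ w)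
      map_add' := fun ℓ ℓ' => by simp
      map_smul' := fun r ℓ => by simp [RCLike.smul_re] } ‖w‖ fun ℓ => by
        refine (RCLike.abs_re_le_norm _).trans ?_
        rw [mul_comm]
        exact ℓ.le_opNorm w

theorem evalRe_apply (w : V) (ℓ : AntiDual 𝕜 V) : evalRe 𝕜 w ℓ = RCLike.re (ℓ w) := rfl

/-- With `d = ℓ w - ℓ' w`, evaluation of the difference at `d • w` gives `conj d * d = |d|²`, which
is real. -/
theorem AntiDual.ext_evalRe {ℓ ℓ' : AntiDual 𝕜 V} (h : ∀ w, evalRe 𝕜 w ℓ = evalRe 𝕜 w ℓ') :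
    ℓ = ℓ' := by
  refine ContinuousLinearMap.ext fun w => ?_
  have h1 := h ((ℓ w - ℓ' w) • w)
  rw [← sub_eq_zero, evalRe_apply, evalRe_apply, ← map_sub, map_smulₛₗ, map_smulₛₗ, smul_eq_mul,
    smul_eq_mul, ← mul_sub, RCLike.conj_mul, ← RCLike.ofReal_pow, RCLike.ofReal_re] at h1
  rwa [pow_eq_zero_iff two_ne_zero, norm_eq_zero, sub_eq_zero] at h1

/-- The Riesz isomorphism from the antidual. -/
theorem exists_riesz (𝕜 V : Type*) [RCLike 𝕜] [NormedAddCommGroup V] [InnerProductSpace 𝕜 V]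
    [CompleteSpace V] :
    ∃ J : AntiDual 𝕜 V →L[𝕜] V, ∀ ℓ w, inner 𝕜 w (J ℓ) = ℓ w := by
  have h : ∀ ℓ : AntiDual 𝕜 V, ∃ v, ∀ w, inner 𝕜 w v = ℓ w := by
    intro ℓ
    -- The conjugate of an antilinear functional is linear, so the usual Riesz theorem applies.
    let ℓ' : StrongDual 𝕜 V := LinearMap.mkContinuous
      { toFun := fun w => starRingEnd 𝕜 (ℓ w)
        map_add' := fun w w' => by simp
        map_smul' := fun c w => by simp } ‖ℓ‖ fun w => by
          simpa using ℓ.le_opNorm w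
    refine ⟨(InnerProductSpace.toDual 𝕜 V).symm ℓ', fun w => ?_⟩
    rw [← inner_conj_symm, InnerProductSpace.toDual_symm_apply]
    exact RCLike.conj_conj _
  choose J hJ using h
  refine ⟨LinearMap.mkContinuous
    { toFun := J
      map_add' := fun ℓ ℓ' => ext_inner_left 𝕜 fun w => by
        rw [inner_add_right, hJ, hJ, hJ, add_apply]
      map_smul' := fun c ℓ => ext_inner_left 𝕜 fun w => by
        rw [RingHom.id_apply, inner_smul_right, hJ, hJ]; rfl } 1 fun ℓ => ?_, hJ⟩
  rw [one_mul]
  change ‖J ℓ‖ ≤ ‖ℓ‖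
  rcases (norm_nonneg (J ℓ)).eq_or_lt with h0 | h0
  · rw [← h0]; exact norm_nonneg _
  · refine le_of_mul_le_mul_right ?_ h0
    rw [← inner_self_eq_norm_mul_norm (𝕜 := 𝕜), hJ]
    exact (RCLike.re_le_norm _).trans (ℓ.le_opNorm _)

/-- The embedding `V → V'`. -/
def gelfand [CompleteSpace V] [CompleteSpace H] (ι : V →L[𝕜] H) : V →L[𝕜] AntiDual 𝕜 V :=
  (innerSLFlip 𝕜).comp (ι.adjoint ∘L ι)

theorem gelfand_apply [CompleteSpace V] [CompleteSpace H] (ι : V →L[𝕜] H) (v : V) :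
    gelfand ι v = toAntiDual ι (ι v) :=
  ContinuousLinearMap.ext fun w => ContinuousLinearMap.adjoint_inner_right ι w (ι v)

/-- The maps `evalRe 𝕜 w` are continuous, so they commute with the integrals, and together they
separate the points of `V'`. -/
theorem isWeakDeriv_iff [CompleteSpace V] [CompleteSpace H] {ι : V →L[𝕜] H} {τ : ℝ} {u : L2 τ V}
    {g : L2 τ (AntiDual 𝕜 V)} :
    IsWeakDeriv ι τ u g ↔ ∀ φ : ℝ → ℝ, IsTest τ φ → ∀ w : V,
      ∫ t, deriv φ t * RCLike.re (inner 𝕜 (ι w) (ι (u t))) ∂(vol τ) =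
        - ∫ t, φ t * RCLike.re (g t w) ∂(vol τ) := by
  have hui : Integrable (fun t => toAntiDual ι (ι (u t))) (vol τ) := by
    simp only [← gelfand_apply]
    exact integrable_of_memLp_two ((gelfand ι).comp_memLp' (Lp.memLp u))
  have hgi := integrable_of_memLp_two (Lp.memLp g)
  have key : ∀ φ, IsTest τ φ → ∀ w,
      evalRe 𝕜 w (∫ t, deriv φ t • toAntiDual ι (ι (u t)) ∂(vol τ)) =
        ∫ t, deriv φ t * RCLike.re (inner 𝕜 (ι w) (ι (u t))) ∂(vol τ) ∧
      evalRe 𝕜 w (- ∫ t, φ t • g t ∂(vol τ)) = - ∫ t, φ t * RCLike.re (g t w) ∂(vol τ) := by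
    intro φ hφ w
    rw [map_neg, ← ContinuousLinearMap.integral_comp_comm _ (hφ.integrable_deriv_smul hui),
      ← ContinuousLinearMap.integral_comp_comm _ (hφ.integrable_smul hgi)]
    simp only [map_smul, evalRe_apply, toAntiDual_apply, smul_eq_mul, and_self]
  refine ⟨fun h φ hφ w => ?_, fun h φ h1 h2 h3 => AntiDual.ext_evalRe fun w => ?_⟩
  · rw [← (key φ hφ w).1, ← (key φ hφ w).2,
      h φ hφ.contDiff hφ.hasCompactSupport hφ.tsupport_subset]
  · rw [(key φ ⟨h1, h2, h3⟩ w).1, (key φ ⟨h1, h2, h3⟩ w).2]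
    exact h φ ⟨h1, h2, h3⟩ w

end AntiDual

/-! ### Reduction from `𝕜` to `ℝ` -/

section Transfer

variable {𝕜 V H : Type*} [RCLike 𝕜]
  [NormedAddCommGroup V] [InnerProductSpace 𝕜 V]
  [NormedAddCommGroup H] [InnerProductSpace 𝕜 H]

section

variable [InnerProductSpace ℝ V] [IsScalarTower ℝ 𝕜 V]

/-- The real part of a form. -/
def realForm (a : ℝ → V →ₗ[𝕜] V →ₗ⋆[𝕜] 𝕜) : ℝ → V →ₗ[ℝ] V →ₗ[ℝ] ℝ := fun t =>
  LinearMap.mk₂ ℝ (fun v w => RCLike.re (a t v w))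
    (fun v v' w => by simp)
    (fun r v w => by
      rw [← algebraMap_smul 𝕜 r v, map_smul, LinearMap.smul_apply, algebraMap_smul,
        RCLike.smul_re, smul_eq_mul])
    (fun v w w' => by simp)
    (fun r v w => by
      rw [← algebraMap_smul 𝕜 r w, map_smulₛₗ, RCLike.algebraMap_eq_ofReal, RCLike.conj_ofReal,
        smul_eq_mul, RCLike.re_ofReal_mul, smul_eq_mul])

theorem realForm_apply (a : ℝ → V →ₗ[𝕜] V →ₗ⋆[𝕜] 𝕜) (t : ℝ) (v w : V) :
    realForm a t v w = RCLike.re (a t v w) := rfl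

variable [InnerProductSpace ℝ H] [IsScalarTower ℝ 𝕜 H]

theorem IsQuasiCoerciveForm.isRealForm {ι : V →L[𝕜] H} {τ : ℝ} {a : ℝ → V →ₗ[𝕜] V →ₗ⋆[𝕜] 𝕜}
    (ha : IsQuasiCoerciveForm ι τ a) : IsRealForm (ι.restrictScalars ℝ) τ (realForm a) := by
  refine ⟨fun v w => ?_, ?_, ?_⟩
  · exact RCLike.measurable_re.comp_aemeasurable
      ((ha.measurable v w).mono_measure (Measure.restrict_mono_set _ Ioo_subset_Icc_self))
  · obtain ⟨M, hM0, hM⟩ := ha.bounded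
    exact ⟨M, hM0, fun t ht v w =>
      (RCLike.abs_re_le_norm _).trans (hM t (Ioo_subset_Icc_self ht) v w)⟩
  · obtain ⟨ω₀, α, hα, h⟩ := ha.quasiCoercive
    exact ⟨ω₀, α, hα, fun t ht v => h t (Ioo_subset_Icc_self ht) v⟩

theorem solvesEquation_iff [CompleteSpace V] [CompleteSpace H]
    (hV : ∀ x y : V, inner ℝ x y = RCLike.re (inner 𝕜 x y))
    (hH : ∀ x y : H, inner ℝ x y = RCLike.re (inner 𝕜 x y))
    {J : AntiDual 𝕜 V →L[𝕜] V} (hJ : ∀ ℓ w, inner 𝕜 w (J ℓ) = ℓ w) {ι : V →L[𝕜] H} {τ : ℝ}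
    {a : ℝ → V →ₗ[𝕜] V →ₗ⋆[𝕜] 𝕜} {f : L2 τ (AntiDual 𝕜 V)} {u : L2 τ V} :
    SolvesEquation ι τ a f u ↔
      RealSolves (ι.restrictScalars ℝ) τ (realForm a) (J.compLp f) u := by
  have hw : ∀ (g : L2 τ (AntiDual 𝕜 V)) (p : L2 τ V),
      (∀ᵐ t ∂(vol τ), ∀ w, inner 𝕜 w (p t) = g t w) →
      ((IsWeakDeriv ι τ u g ∧ ∀ w : V, ∀ᵐ t ∂(vol τ), g t w + a t (u t) w = f t w) ↔
      (IsRealWeakDeriv (ι.restrictScalars ℝ) τ u p ∧ ∀ w : V, ∀ᵐ t ∂(vol τ),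
        inner ℝ w (p t) + realForm a t (u t) w = inner ℝ w (J.compLp f t))) := by
    intro g p hgp
    rw [isWeakDeriv_iff]
    refine and_congr ?_ ?_
    · refine forall_congr' fun φ => forall_congr' fun _ => forall_congr' fun w => ?_
      have e2 : ∫ t, φ t * RCLike.re (g t w) ∂(vol τ) = ∫ t, φ t * inner ℝ w (p t) ∂(vol τ) := by
        refine integral_congr_ae ?_
        filter_upwards [hgp] with t ht
        rw [hV, ht]
      rw [e2]
      simp only [hH, ContinuousLinearMap.coe_restrictScalars']
    · have h1 : ∀ w : V, ∀ᵐ t ∂(vol τ),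
          (inner ℝ w (p t) + realForm a t (u t) w = inner ℝ w (J.compLp f t) ↔
            RCLike.re (g t w + a t (u t) w) = RCLike.re (f t w)) := by
        intro w
        filter_upwards [hgp, J.coeFn_compLp f] with t ht1 ht2
        rw [ht2, hV, hV, ht1, hJ, realForm_apply, map_add]
      refine ⟨fun h w => ?_, fun h w => ?_⟩
      · filter_upwards [h w, h1 w] with t ht ht1
        rw [ht1, ht]
      -- By antilinearity the real part at `I • w` is the imaginary part at `w`. For `𝕜 = ℝ` one has
      -- `I = 0` and both sides are zero.
      · filter_upwards [h w, h1 w, h ((RCLike.I : 𝕜) • w), h1 ((RCLike.I : 𝕜) • w)]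
          with t h2 h3 h4 h5
        refine RCLike.ext (h3.1 h2) ?_
        have h6 := h5.1 h4
        rw [map_smulₛₗ, map_smulₛₗ, map_smulₛₗ, ← smul_add] at h6
        simp only [smul_eq_mul, RCLike.conj_I, neg_mul, map_neg, RCLike.I_mul_re, neg_neg] at h6
        exact h6
  constructor
  · rintro ⟨g, hg⟩
    refine ⟨J.compLp g, (hw g _ ?_).1 hg⟩
    filter_upwards [J.coeFn_compLp g] with t ht w
    rw [ht, hJ]
  · rintro ⟨p, hp⟩
    -- The map `v ↦ (w ↦ inner 𝕜 w v)` is inverse to the Riesz map and turns `p` back into a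
    -- function with values in `V'`.
    refine ⟨((innerSLFlip 𝕜 : V →L[𝕜] V →L⋆[𝕜] 𝕜)).compLp p, (hw _ p ?_).2 hp⟩
    filter_upwards [ContinuousLinearMap.coeFn_compLp (innerSLFlip 𝕜 : V →L[𝕜] V →L⋆[𝕜] 𝕜) p]
      with t ht w
    rw [ht]
    rfl

end

theorem isScalarTower_rclikeToReal (𝕜 V : Type*) [RCLike 𝕜] [NormedAddCommGroup V]
    [InnerProductSpace 𝕜 V] :
    letI := InnerProductSpace.rclikeToReal 𝕜 V
    IsScalarTower ℝ 𝕜 V := by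
  let _ := InnerProductSpace.rclikeToReal 𝕜 V
  refine ⟨fun r c v => ?_⟩
  change (r • c) • v = (r : 𝕜) • c • v
  rw [smul_smul, RCLike.real_smul_eq_coe_mul]

variable [CompleteSpace V] [CompleteSpace H] {ι : V →L[𝕜] H} {τ : ℝ}
  {a : ℝ → V →ₗ[𝕜] V →ₗ⋆[𝕜] 𝕜}

theorem exists_solvesInitial (ha : IsQuasiCoerciveForm ι τ a) (hι : Function.Injective ι)
    (hdense : DenseRange ι) (hτ : 0 < τ) (f : L2 τ (AntiDual 𝕜 V)) (x : H) :
    ∃ u, SolvesInitial ι τ a f x u := by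
  let _ := InnerProductSpace.rclikeToReal 𝕜 V
  let _ := InnerProductSpace.rclikeToReal 𝕜 H
  have := isScalarTower_rclikeToReal 𝕜 V
  have := isScalarTower_rclikeToReal 𝕜 H
  obtain ⟨J, hJ⟩ := exists_riesz 𝕜 V
  obtain ⟨u, hu, c, h1, h2, h3⟩ := exists_realSolves ha.isRealForm hι hdense hτ (J.compLp f) x
  exact ⟨u, (solvesEquation_iff (fun _ _ => rfl) (fun _ _ => rfl) hJ).2 hu, c, ⟨h1, h2⟩, h3⟩

theorem SolvesInitial.eq_zero (ha : IsQuasiCoerciveForm ι τ a) (hι : Function.Injective ι)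
    (hτ : 0 < τ) {u : L2 τ V} (h : SolvesInitial ι τ a 0 0 u) : u = 0 := by
  let _ := InnerProductSpace.rclikeToReal 𝕜 V
  let _ := InnerProductSpace.rclikeToReal 𝕜 H
  have := isScalarTower_rclikeToReal 𝕜 V
  have := isScalarTower_rclikeToReal 𝕜 H
  obtain ⟨J, hJ⟩ := exists_riesz 𝕜 V
  obtain ⟨hu, c, ⟨h1, h2⟩, h3⟩ := h
  have hr := (solvesEquation_iff (fun _ _ => rfl) (fun _ _ => rfl) hJ).1 hu
  have h0 : J.compLp (0 : L2 τ (AntiDual 𝕜 V)) = 0 := map_zero (J.compLpL 2 (vol τ))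
  rw [h0] at hr
  exact hr.eq_zero ha.isRealForm hι hτ h1 h2 h3

end Transfer

/-! ### Superposition, cutoff and the equivalence -/

section WellPosedness

variable {𝕜 V H : Type*} [RCLike 𝕜]
  [NormedAddCommGroup V] [InnerProductSpace 𝕜 V]
  [NormedAddCommGroup H] [InnerProductSpace 𝕜 H] {ι : V →L[𝕜] H} {τ : ℝ}
  {a : ℝ → V →ₗ[𝕜] V →ₗ⋆[𝕜] 𝕜}

theorem IsContRep.eqOn (hτ : 0 < τ) {u : L2 τ V} {c d : ℝ → H} (hc : IsContRep ι τ u c)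
    (hd : IsContRep ι τ u d) : EqOn c d (Icc 0 τ) :=
  eqOn_Icc_of_ae_eq hτ hc.1 hd.1 (by
    filter_upwards [hc.2, hd.2] with t h1 h2 using h1.trans h2.symm)

theorem IsContRep.add_smul {u v : L2 τ V} {c d : ℝ → H} (hc : IsContRep ι τ u c)
    (hd : IsContRep ι τ v d) (k : 𝕜) : IsContRep ι τ (u + k • v) (fun t => c t + k • d t) := by
  refine ⟨hc.1.add (hd.1.const_smul k), ?_⟩
  filter_upwards [hc.2, hd.2, Lp.coeFn_add u (k • v), Lp.coeFn_smul k v] with t h1 h2 h3 h4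
  rw [h3, Pi.add_apply, h4, Pi.smul_apply, map_add, map_smul, h1, h2]

theorem integrable_mul_re_inner (φ : ℝ → ℝ) (hφ : ∀ p : ℝ → ℝ, Integrable p (vol τ) →
    Integrable (fun t => φ t * p t) (vol τ)) (ι : V →L[𝕜] H) (w : V) (u : L2 τ V) :
    Integrable (fun t => φ t * RCLike.re (inner 𝕜 (ι w) (ι (u t)))) (vol τ) :=
  hφ _ ((integrable_of_memLp_two (ι.comp_memLp' (Lp.memLp u))).const_inner _).re

theorem integrable_mul_re_apply (φ : ℝ → ℝ) (hφ : ∀ p : ℝ → ℝ, Integrable p (vol τ) →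
    Integrable (fun t => φ t * p t) (vol τ)) (w : V) (g : L2 τ (AntiDual 𝕜 V)) :
    Integrable (fun t => φ t * RCLike.re (g t w)) (vol τ) :=
  hφ _ ((evalRe 𝕜 w).integrable_comp (integrable_of_memLp_two (Lp.memLp g)))

theorem memLp_cutoff_smul (hτ : 0 < τ) {E : Type*} [NormedAddCommGroup E] [NormedSpace 𝕜 E]
    (p : L2 τ E) : MemLp (fun t => ((1 - t / τ : ℝ) : 𝕜) • p t) 2 (vol τ) := by
  refine (Lp.memLp p).of_le ?_ ?_
  · have hc : Continuous fun t : ℝ => ((1 - t / τ : ℝ) : 𝕜) :=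
      RCLike.continuous_ofReal.comp (by fun_prop)
    exact hc.aestronglyMeasurable.smul (Lp.memLp p).1
  · filter_upwards [ae_restrict_mem measurableSet_Ioo] with t ht
    rw [norm_smul, RCLike.norm_ofReal]
    refine mul_le_of_le_one_left (norm_nonneg _) ?_
    have h1 : 0 ≤ t / τ := div_nonneg ht.1.le hτ.le
    have h2 : t / τ ≤ 1 := (div_le_one hτ).2 ht.2.le
    rw [abs_le]
    constructor <;> linarith

variable [CompleteSpace V] [CompleteSpace H]

/-- Taking real parts is not `𝕜`-linear, so the scalar `k` is moved into the test vector as `conj k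
• w`. -/
theorem IsWeakDeriv.add_smul {u v : L2 τ V} {g h : L2 τ (AntiDual 𝕜 V)}
    (hu : IsWeakDeriv ι τ u g) (hv : IsWeakDeriv ι τ v h) (k : 𝕜) :
    IsWeakDeriv ι τ (u + k • v) (g + k • h) := by
  rw [isWeakDeriv_iff] at hu hv ⊢
  intro φ hφ w
  have e1 : ∫ t, deriv φ t * RCLike.re (inner 𝕜 (ι w) (ι ((u + k • v) t))) ∂(vol τ) =
      (∫ t, deriv φ t * RCLike.re (inner 𝕜 (ι w) (ι (u t))) ∂(vol τ)) +
      ∫ t, deriv φ t * RCLike.re (inner 𝕜 (ι (starRingEnd 𝕜 k • w)) (ι (v t))) ∂(vol τ) := by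
    have hi := fun (p : ℝ → ℝ) (hp : Integrable p (vol τ)) => hφ.integrable_deriv_smul hp
    rw [← integral_add (integrable_mul_re_inner _ hi ι w u)
      (integrable_mul_re_inner _ hi ι (starRingEnd 𝕜 k • w) v)]
    refine integral_congr_ae ?_
    filter_upwards [Lp.coeFn_add u (k • v), Lp.coeFn_smul k v] with t h1 h2
    rw [h1, Pi.add_apply, h2, Pi.smul_apply, map_add, map_smul, map_smul, inner_add_right,
      inner_smul_left, inner_smul_right, RCLike.conj_conj, map_add, mul_add]
  have e2 : ∫ t, φ t * RCLike.re ((g + k • h) t w) ∂(vol τ) =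
      (∫ t, φ t * RCLike.re (g t w) ∂(vol τ)) +
      ∫ t, φ t * RCLike.re (h t (starRingEnd 𝕜 k • w)) ∂(vol τ) := by
    have hi := fun (p : ℝ → ℝ) (hp : Integrable p (vol τ)) => hφ.integrable_smul hp
    rw [← integral_add (integrable_mul_re_apply _ hi w g)
      (integrable_mul_re_apply _ hi (starRingEnd 𝕜 k • w) h)]
    refine integral_congr_ae ?_
    filter_upwards [Lp.coeFn_add g (k • h), Lp.coeFn_smul k h] with t h1 h2
    rw [h1, Pi.add_apply, h2, Pi.smul_apply, add_apply, smul_apply,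
      map_smulₛₗ, RCLike.conj_conj, map_add, mul_add]
  rw [e1, e2, hu φ hφ w, hv φ hφ, neg_add]

theorem SolvesEquation.add_smul {u v : L2 τ V} {f h : L2 τ (AntiDual 𝕜 V)}
    (hu : SolvesEquation ι τ a f u) (hv : SolvesEquation ι τ a h v) (k : 𝕜) :
    SolvesEquation ι τ a (f + k • h) (u + k • v) := by
  obtain ⟨g₁, h1, h2⟩ := hu
  obtain ⟨g₂, h3, h4⟩ := hv
  refine ⟨g₁ + k • g₂, h1.add_smul h3 k, fun w => ?_⟩
  filter_upwards [h2 w, h4 w, Lp.coeFn_add u (k • v), Lp.coeFn_smul k v, Lp.coeFn_add f (k • h),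
    Lp.coeFn_smul k h, Lp.coeFn_add g₁ (k • g₂), Lp.coeFn_smul k g₂] with t e1 e2 e3 e4 e5 e6 e7 e8
  rw [e3, e5, e7, Pi.add_apply, Pi.add_apply, Pi.add_apply, e4, e6, e8, Pi.smul_apply,
    Pi.smul_apply, Pi.smul_apply, add_apply, add_apply, smul_apply,
    smul_apply, map_add, map_smul, LinearMap.add_apply, LinearMap.smul_apply,
    ← e1, ← e2, smul_add]
  abel

theorem SolvesInitial.add_smul {u v : L2 τ V} {f h : L2 τ (AntiDual 𝕜 V)} {x y : H}
    (hu : SolvesInitial ι τ a f x u) (hv : SolvesInitial ι τ a h y v) (k : 𝕜) :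
    SolvesInitial ι τ a (f + k • h) (x + k • y) (u + k • v) := by
  obtain ⟨h1, c, h2, h3⟩ := hu
  obtain ⟨h4, d, h5, h6⟩ := hv
  exact ⟨h1.add_smul h4 k, _, h2.add_smul h5 k, by simp only [h3, h6]⟩

theorem SolvesInitial.unique (ha : IsQuasiCoerciveForm ι τ a) (hι : Function.Injective ι)
    (hτ : 0 < τ) {f : L2 τ (AntiDual 𝕜 V)} {x : H} {u v : L2 τ V}
    (hu : SolvesInitial ι τ a f x u) (hv : SolvesInitial ι τ a f x v) : u = v := by
  have h := hu.add_smul hv (-1 : 𝕜)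
  simp only [neg_smul, one_smul, add_neg_cancel] at h
  have := h.eq_zero ha hι hτ
  rwa [add_neg_eq_zero] at this

/-- Multiplication of a solution of the homogeneous equation by the function `1 - t / τ`. -/
theorem SolvesEquation.exists_cutoff (hτ : 0 < τ) {u : L2 τ V} (hu : SolvesEquation ι τ a 0 u) :
    ∃ (z : L2 τ V) (f : L2 τ (AntiDual 𝕜 V)), SolvesEquation ι τ a f z ∧
      ∀ᵐ t ∂(vol τ), z t = ((1 - t / τ : ℝ) : 𝕜) • u t := by
  obtain ⟨g, hg, he⟩ := hu
  set z : L2 τ V := (memLp_cutoff_smul (𝕜 := 𝕜) hτ u).toLp _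
  set g' : L2 τ (AntiDual 𝕜 V) := (memLp_cutoff_smul (𝕜 := 𝕜) hτ g).toLp _
  have hzc : ∀ᵐ t ∂(vol τ), z t = ((1 - t / τ : ℝ) : 𝕜) • u t :=
    (memLp_cutoff_smul (𝕜 := 𝕜) hτ u).coeFn_toLp
  have hgc : ∀ᵐ t ∂(vol τ), g' t = ((1 - t / τ : ℝ) : 𝕜) • g t :=
    (memLp_cutoff_smul (𝕜 := 𝕜) hτ g).coeFn_toLp
  -- With `m = 1 - t/τ` the product rule gives `(mu)' + 𝒜(mu) = m (u' + 𝒜u) + m' u`, which is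
  -- `-u/τ`.
  set f : L2 τ (AntiDual 𝕜 V) := ((-(1 / τ) : ℝ) : 𝕜) • (gelfand ι).compLp u
  have hfc : ∀ᵐ t ∂(vol τ), f t = ((-(1 / τ) : ℝ) : 𝕜) • toAntiDual ι (ι (u t)) := by
    filter_upwards [Lp.coeFn_smul ((-(1 / τ) : ℝ) : 𝕜) ((gelfand ι).compLp u),
      (gelfand ι).coeFn_compLp u] with t h1 h2
    rw [h1, Pi.smul_apply, h2, gelfand_apply]
  refine ⟨z, f, ⟨g' + f, ?_, fun w => ?_⟩, hzc⟩
  · rw [isWeakDeriv_iff] at hg ⊢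
    intro φ hφ w
    have hmc : ContDiff ℝ ∞ fun t : ℝ => 1 - t / τ := by fun_prop
    -- The product rule in weak form: the factor is moved onto the test function.
    have hφm : IsTest τ fun t => (1 - t / τ) * φ t :=
      ⟨hmc.mul hφ.contDiff, hφ.hasCompactSupport.mul_left,
        tsupport_mul_subset_right.trans hφ.tsupport_subset⟩
    have hd : ∀ t, deriv (fun t => (1 - t / τ) * φ t) t =
        (1 - t / τ) * deriv φ t - 1 / τ * φ t := by
      intro t
      have h1 : HasDerivAt (fun t : ℝ => 1 - t / τ) (-(1 / τ)) t :=
        ((hasDerivAt_id t).div_const τ).const_sub 1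
      refine (h1.mul (hφ.hasDerivAt t)).deriv.trans ?_
      ring
    have key := hg _ hφm w
    simp only [hd] at key
    have hi := fun (p : ℝ → ℝ) (hp : Integrable p (vol τ)) => hφ.integrable_smul hp
    have hi' := fun (p : ℝ → ℝ) (hp : Integrable p (vol τ)) => hφ.integrable_deriv_smul hp
    have e1 : ∫ t, deriv φ t * RCLike.re (inner 𝕜 (ι w) (ι (z t))) ∂(vol τ) =
        (∫ t, ((1 - t / τ) * deriv φ t - 1 / τ * φ t) *
            RCLike.re (inner 𝕜 (ι w) (ι (u t))) ∂(vol τ)) +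
          1 / τ * ∫ t, φ t * RCLike.re (inner 𝕜 (ι w) (ι (u t))) ∂(vol τ) := by
      rw [← integral_const_mul, ← integral_add]
      · refine integral_congr_ae ?_
        filter_upwards [hzc] with t h1
        rw [h1, map_smul, inner_smul_right, RCLike.re_ofReal_mul]
        ring
      · have h1 := hφm.integrable_deriv_smul
          (((integrable_of_memLp_two (ι.comp_memLp' (Lp.memLp u))).const_inner (𝕜 := 𝕜) (ι w)).re)
        simp only [hd] at h1
        exact h1
      · exact (integrable_mul_re_inner _ hi ι w u).const_mul _
    have e2 : ∫ t, φ t * RCLike.re ((g' + f) t w) ∂(vol τ) =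
        (∫ t, (1 - t / τ) * φ t * RCLike.re (g t w) ∂(vol τ)) -
          1 / τ * ∫ t, φ t * RCLike.re (inner 𝕜 (ι w) (ι (u t))) ∂(vol τ) := by
      rw [← integral_const_mul, ← integral_sub]
      · refine integral_congr_ae ?_
        filter_upwards [hgc, hfc, Lp.coeFn_add g' f] with t h1 h2 h3
        rw [h3, Pi.add_apply, h1, h2, add_apply, smul_apply,
          smul_apply, smul_eq_mul, smul_eq_mul, map_add,
          RCLike.re_ofReal_mul, RCLike.re_ofReal_mul, toAntiDual_apply]
        ring
      · exact integrable_mul_re_apply _ (fun p hp => hφm.integrable_smul hp) w g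
      · exact (integrable_mul_re_inner _ hi ι w u).const_mul _
    rw [e1, e2, key]
    ring
  · filter_upwards [he w, hzc, hgc, Lp.coeFn_add g' f, Lp.coeFn_zero (AntiDual 𝕜 V) 2 (vol τ)]
      with t h1 h2 h3 h4 h5
    rw [h5, Pi.zero_apply, zero_apply] at h1
    rw [h4, Pi.add_apply, h2, h3, add_apply, smul_apply, map_smul,
      LinearMap.smul_apply, add_right_comm, ← smul_add, h1, smul_zero, zero_add]

theorem exists_isSolutionOperator (ha : IsQuasiCoerciveForm ι τ a) (hι : Function.Injective ι)
    (hdense : DenseRange ι) (hτ : 0 < τ) : ∃ T : H →ₗ[𝕜] H, IsSolutionOperator ι τ a T := by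
  choose v hv using fun x => exists_solvesInitial ha hι hdense hτ 0 x
  choose c hc using fun x => (hv x).2
  -- By uniqueness the chosen solution for `x + k • y` is the combination of the chosen solutions,
  -- and so are the continuous representatives.
  have hlin : ∀ x y (k : 𝕜), c (x + k • y) τ = c x τ + k • c y τ := by
    intro x y k
    have h1 := (hv x).add_smul (hv y) k
    rw [smul_zero, add_zero] at h1
    have h2 := h1.unique ha hι hτ (hv (x + k • y))
    have h3 := (hc x).1.add_smul (hc y).1 k
    rw [h2] at h3
    exact (hc (x + k • y)).1.eqOn hτ h3 ⟨hτ.le, le_rfl⟩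
  have h0 : c 0 τ = 0 := by
    have := hlin 0 0 1
    simpa using this
  refine ⟨{ toFun := fun x => c x τ
            map_add' := fun x y => by simpa using hlin x y 1
            map_smul' := fun k x => by simpa [h0] using hlin 0 x k },
    fun x => ⟨⟨v x, hv x, ?_⟩, ?_⟩⟩
  · exact fun u hu => hu.unique ha hι hτ (hv x)
  · intro u hu
    rw [hu.unique ha hι hτ (hv x)]
    exact ⟨c x, (hc x).1, rfl⟩

theorem wellPosed_iff_bijective (ha : IsQuasiCoerciveForm ι τ a) (hι : Function.Injective ι)
    (hdense : DenseRange ι) (hτ : 0 < τ) {T : H →ₗ[𝕜] H} (hT : IsSolutionOperator ι τ a T)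
    (Φ : H →ₗ[𝕜] H) :
    WellPosed ι τ a Φ ↔ Function.Bijective (LinearMap.id - Φ ∘ₗ T : H →ₗ[𝕜] H) := by
  have hτm : τ ∈ Icc 0 τ := ⟨hτ.le, le_rfl⟩
  have h0m : (0 : ℝ) ∈ Icc 0 τ := ⟨le_rfl, hτ.le⟩
  have hTc : ∀ {x v c}, SolvesEquation ι τ a 0 v → IsContRep ι τ v c → c 0 = x → c τ = T x := by
    intro x v c h1 h2 h3
    obtain ⟨d, hd, hdT⟩ := (hT x).2 v ⟨h1, c, h2, h3⟩
    rw [h2.eqOn hτ hd hτm, hdT]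
  have happ : ∀ x, (LinearMap.id - Φ ∘ₗ T : H →ₗ[𝕜] H) x = x - Φ (T x) := fun _ => rfl
  have hrep0 : IsContRep ι τ (0 : L2 τ V) (fun _ => (0 : H)) := by
    refine ⟨continuousOn_const, ?_⟩
    filter_upwards [Lp.coeFn_zero V 2 (vol τ)] with t ht
    rw [ht, Pi.zero_apply, map_zero]
  constructor
  · intro h
    constructor
    · rw [injective_iff_map_eq_zero]
      intro x hx
      rw [happ, sub_eq_zero] at hx
      obtain ⟨v, ⟨hv, c, hc, hc0⟩, -⟩ := (hT x).1
      have hcτ := hTc hv hc hc0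
      have hv0 : SolvesGeneralized ι τ a Φ 0 v := ⟨hv, c, hc, by rw [hc0, hcτ, ← hx]⟩
      have hz : SolvesGeneralized ι τ a Φ 0 0 := by
        refine ⟨?_, _, hrep0, (map_zero Φ).symm⟩
        have := hv.add_smul hv (-1 : 𝕜)
        simpa only [neg_smul, one_smul, add_neg_cancel] using this
      have hvz : v = 0 := (h 0).unique hv0 hz
      subst hvz
      rw [← hc0, hc.eqOn hτ hrep0 h0m]
    · intro y
      obtain ⟨v, ⟨hv, c, hc, hc0⟩, -⟩ := (hT y).1
      -- The cutoff keeps the initial value `y` and has final value `0`, so it contributes nothing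
      -- to `Φ (u(τ))`.
      obtain ⟨z, f, hz, hzv⟩ := hv.exists_cutoff hτ
      have hzc : IsContRep ι τ z (fun t => ((1 - t / τ : ℝ) : 𝕜) • c t) := by
        refine ⟨?_, ?_⟩
        · have : Continuous fun t : ℝ => ((1 - t / τ : ℝ) : 𝕜) :=
            RCLike.continuous_ofReal.comp (by fun_prop)
          exact this.continuousOn.smul hc.1
        · filter_upwards [hc.2, hzv] with t h1 h2
          rw [h1, h2, map_smul]
      obtain ⟨u, ⟨hu, d, hd, hd0⟩, -⟩ := h f
      have hw := hu.add_smul hz (-1 : 𝕜)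
      have hwc := hd.add_smul hzc (-1 : 𝕜)
      rw [neg_smul, one_smul, add_neg_cancel] at hw
      have hwτ := hTc hw hwc rfl
      simp only [div_self hτ.ne', sub_self, RCLike.ofReal_zero, zero_smul, smul_zero, add_zero,
        zero_div, sub_zero, RCLike.ofReal_one, one_smul, neg_smul, hc0] at hwτ
      refine ⟨-(d 0 + -y), ?_⟩
      rw [map_neg, happ, ← hwτ, ← hd0]
      abel
  · intro h f
    refine existsUnique_of_exists_of_unique ?_ ?_
    · obtain ⟨w, hw, d, hd, hd0⟩ := exists_solvesInitial ha hι hdense hτ f 0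
      -- This `x` is the initial value that the homogeneous part must have for the sum to satisfy
      -- the condition.
      obtain ⟨x, hx⟩ := h.2 (Φ (d τ))
      rw [happ] at hx
      obtain ⟨v, ⟨hv, c, hc, hc0⟩, -⟩ := (hT x).1
      have h1 := hw.add_smul hv (1 : 𝕜)
      rw [smul_zero, add_zero] at h1
      refine ⟨_, h1, _, hd.add_smul hc 1, ?_⟩
      simp only [one_smul, hd0, hc0, hTc hv hc hc0, map_add, ← hx]
      abel
    · rintro u v ⟨hu, c, hc, hc0⟩ ⟨hv, d, hd, hd0⟩
      have h1 := hu.add_smul hv (-1 : 𝕜)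
      have h2 := hc.add_smul hd (-1 : 𝕜)
      rw [neg_smul, one_smul, add_neg_cancel] at h1
      have h3 := hTc h1 h2 rfl
      -- The difference of two solutions is homogeneous, and its initial value lies in the kernel of
      -- `I - Φ T`.
      have h4 : c 0 + (-1 : 𝕜) • d 0 = 0 := by
        refine (injective_iff_map_eq_zero _).1 h.1 _ ?_
        rw [happ, ← h3, hc0, hd0, map_add, map_smul, sub_self]
      have h5 := SolvesInitial.eq_zero ha hι hτ ⟨h1, _, h2, h4⟩
      rwa [neg_smul, one_smul, add_neg_eq_zero] at h5

end WellPosedness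

end LionsProblem

end

theorem theorem4p5 {𝕜 V H : Type*} [RCLike 𝕜]
    [NormedAddCommGroup V] [InnerProductSpace 𝕜 V] [CompleteSpace V]
    [NormedAddCommGroup H] [InnerProductSpace 𝕜 H] [CompleteSpace H]
    (ι : V →L[𝕜] H) (hι : Function.Injective ι) (hdense : DenseRange ι)
    (τ : ℝ) (hτ : 0 < τ)
    (a : ℝ → V →ₗ[𝕜] V →ₗ⋆[𝕜] 𝕜) (ha : LionsProblem.IsQuasiCoerciveForm ι τ a) :
    ∃ T : H →ₗ[𝕜] H, LionsProblem.IsSolutionOperator ι τ a T ∧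
      ∀ Φ : H →ₗ[𝕜] H,
        (LionsProblem.WellPosed ι τ a Φ ↔
          Function.Bijective (LinearMap.id - Φ ∘ₗ T : H →ₗ[𝕜] H)) := by
  obtain ⟨T, hT⟩ := LionsProblem.exists_isSolutionOperator ha hι hdense hτ
  exact ⟨T, hT, LionsProblem.wellPosed_iff_bijective ha hι hdense hτ hT⟩
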